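/- All graphs are finite and simple, and a subgraph $H$ of $G$ (induced or not) is called proper if $H\neq G$. For $n\ge 4$, the wheel $W_n$ is the graph on $n$ vertices $c,w_1,\dots,w_{n-1}$ whose edges are $cw_i$ and $w_iw_{i+1}$ for $1\le i\le n-1$ (indices modulo $n-1$). For $n\ge 4$, let $H_n$ be the graph on $n$ vertices $x,y,v_1,\dots,v_{n-2}$ with edges $v_iv_{i+1}$ for $1\le i\le n-3$, $xv_i$ for $1\le i\le n-2$, $yv_1$ and $yv_{n-2}$; the vertices $x$ and $y$ are called the connectors of $H_n$. Let $G$ be a graph with $n\ge 2$ vertices. Then $G$ has exactly $2n-2$ edges and no proper (not necessarily induced) subgraph of minimum degree $3$ if and only if $G$ is isomorphic to the wheel $W_n$ (with $n\ge 4$), or $G$ is isomorphic to a graph formed, for some $i,j\ge 4$, from disjoint copies of $H_i$, with connectors $x,y$, and of $H_j$, with connectors $x',y'$, by identifying either $x$ with $x'$ and $y$ with $y'$, or $x$ with $y'$ and $y$ with $x'$. -/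

import Mathlib

/-- The wheel with `m` outside vertices `some 0, …, some (m - 1)`, in this cyclic order, and
centre `none`; it has `m + 1` vertices. -/
def wheelGraph (m : ℕ) : SimpleGraph (Option (Fin m)) where
  Adj
    | none, none => False
    | none, some _ => True
    | some _, none => True
    | some i, some j => (SimpleGraph.cycleGraph m).Adj i j
  symm := ⟨by
    rintro (_ | i) (_ | j) h
    · exact h
    · trivial
    · trivial
    · exact SimpleGraph.Adj.symm h⟩
  loopless := ⟨by
    rintro (_ | i) h
    · exact h
    · exact SimpleGraph.irrefl _ h⟩

/-- `G` is a wheel: a copy of a wheel with at least three outside vertices. -/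
def IsWheel {V : Type*} (G : SimpleGraph V) : Prop :=
  ∃ m : ℕ, 3 ≤ m ∧ Nonempty (G ≃g wheelGraph m)

/-- The `n` vertices (for `2 ≤ n`) of the graph `H_n`: the connectors `x` and `y`, and the internal
vertices `v 0, …, v (n - 3)`. -/
inductive HVertex (n : ℕ) : Type
  | x : HVertex n
  | y : HVertex n
  | v (i : Fin (n - 2)) : HVertex n

/-- The edges of `H_n`, each listed in one direction. -/
inductive HEdge (n : ℕ) : HVertex n → HVertex n → Prop
  | path (i j : Fin (n - 2)) (h : (i : ℕ) + 1 = j) : HEdge n (.v i) (.v j)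
  | x (i : Fin (n - 2)) : HEdge n .x (.v i)
  | y_first (i : Fin (n - 2)) (h : (i : ℕ) = 0) : HEdge n .y (.v i)
  | y_last (i : Fin (n - 2)) (h : (i : ℕ) + 1 = n - 2) : HEdge n .y (.v i)

/-- The graph `H_n` (used for `4 ≤ n`): a path on the internal vertices, with `x` joined to all of
them and `y` joined to the first and the last of them. -/
def HGraph (n : ℕ) : SimpleGraph (HVertex n) := SimpleGraph.fromRel (HEdge n)

/-- `G` is formed from a copy of `H_i` and a copy of `H_j`, for some `i, j ≥ 4`, that share exactly
their connectors, identified as `x = x'`, `y = y'` or as `x = y'`, `y = x'`. -/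
def IsHGluing {V : Type*} (G : SimpleGraph V) : Prop :=
  ∃ i j : ℕ, 4 ≤ i ∧ 4 ≤ j ∧ ∃ (f : HVertex i ↪ V) (g : HVertex j ↪ V),
    ((f .x = g .x ∧ f .y = g .y) ∨ (f .x = g .y ∧ f .y = g .x)) ∧
    Set.range f ∩ Set.range g = {f .x, f .y} ∧
    Set.range f ∪ Set.range g = Set.univ ∧
    G = (HGraph i).map f ⊔ (HGraph j).map g

open Classical in
/-- The finite graph `G` has `2 |G| - 2` edges and no proper (not necessarily induced) subgraph of
minimum degree `3`. -/
def NonInducedCritical {V : Type*} [Fintype V] (G : SimpleGraph V) : Prop :=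
  G.edgeSet.ncard + 2 = 2 * Fintype.card V ∧
    ∀ H : G.Subgraph, H ≠ ⊤ → H.coe.minDegree ≠ 3

/-! Write e(U) for the number of edges inside U. Any subgraph of minimum degree at least three
contains one of minimum degree exactly three (`exists_minDegree_eq_three`), so in a critical G every
proper nonempty subgraph has a vertex of degree at most two. Removing such vertices one at a time
gives e(U) ≤ 2|U| - 3 for proper U with |U| ≥ 2 (`adjPairs_self_le`). Hence G has minimum degree at
least three, and the set T of vertices of degree at least four is independent, since an edge inside
T could be deleted.

Let P be a component of the subgraph induced by the cubic vertices. If at most one vertex lies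
outside P, then G is a wheel (`IsTight.isWheel_of_card_compl_le`). Otherwise the bound for the
complement of P forces P to be a tree. If all components are trees, counting edges gives exactly
2|T| - 2 of them (`IsTight.card_parts`). Deleting one component leaves a vertex of degree at most
two, which lies in T; if |T| ≥ 3, two components share such a vertex, and an edge count rules this
out (`IsTight.card_compl_cubic_le_two`). So |T| = 2, there are two trees, and each of them together
with T carries a copy of some H_n (`exists_hCopy`).

Conversely, a subgraph of minimum degree at least three contains all edges at each of its cubic
vertices. In a wheel or a gluing this spreads until the subgraph is everything. -/

open Finset

/-! ### Counting edges by degree sums -/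

section degreeSums

open Classical in
/-- The number of neighbours of `v` in `U`. -/
noncomputable def degIn {V : Type*} (G : SimpleGraph V) (U : Finset V) (v : V) : ℕ :=
  #{w ∈ U | G.Adj v w}

/-- The number of ordered pairs of adjacent vertices in `A × B`. -/
noncomputable def adjPairs {V : Type*} (G : SimpleGraph V) (A B : Finset V) : ℕ :=
  ∑ a ∈ A, degIn G B a

variable {V : Type*} {G : SimpleGraph V}

theorem adjPairs_comm (A B : Finset V) : adjPairs G A B = adjPairs G B A := by
  classical
  have h := Finset.sum_card_bipartiteAbove_eq_sum_card_bipartiteBelow (s := A) (t := B) G.Adj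
  simp only [Finset.bipartiteAbove, Finset.bipartiteBelow] at h
  unfold adjPairs degIn
  convert h using 4
  exact G.adj_comm _ _

theorem degIn_union [DecidableEq V] {A B : Finset V} (h : Disjoint A B) (v : V) :
    degIn G (A ∪ B) v = degIn G A v + degIn G B v := by
  classical
  unfold degIn
  rw [filter_union, card_union_of_disjoint]
  exact disjoint_filter_filter h

theorem degIn_mono {A B : Finset V} (h : A ⊆ B) (v : V) : degIn G A v ≤ degIn G B v := by
  classical
  exact card_le_card (filter_subset_filter _ h)

theorem degIn_singleton_self (v : V) : degIn G {v} v = 0 := by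
  simp [degIn, filter_singleton]

theorem degIn_singleton_of_adj {v w : V} (h : G.Adj v w) : degIn G {w} v = 1 := by
  simp [degIn, filter_singleton, h]

theorem degIn_singleton_of_not_adj {v w : V} (h : ¬ G.Adj v w) : degIn G {w} v = 0 := by
  simp [degIn, filter_singleton, h]

theorem degIn_singleton_le (v w : V) : degIn G {w} v ≤ 1 := by
  by_cases h : G.Adj v w
  · rw [degIn_singleton_of_adj h]
  · rw [degIn_singleton_of_not_adj h]; omega

theorem adj_of_degIn_singleton {v w : V} (h : degIn G {w} v ≠ 0) : G.Adj v w := by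
  by_contra h'
  exact h (degIn_singleton_of_not_adj h')

theorem degIn_eq_zero {U : Finset V} {v : V} (h : ∀ w ∈ U, ¬ G.Adj v w) : degIn G U v = 0 := by
  classical
  simpa [degIn, filter_eq_empty_iff] using h

theorem degIn_pos {U : Finset V} {v w : V} (hw : w ∈ U) (h : G.Adj v w) : 1 ≤ degIn G U v :=
  card_pos.2 ⟨w, by simp [hw, h]⟩

theorem degIn_le_card (U : Finset V) (v : V) : degIn G U v ≤ #U := by
  classical
  exact card_filter_le _ _

theorem degIn_add_one_le_card {U : Finset V} {v : V} (hv : v ∈ U) : degIn G U v + 1 ≤ #U := by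
  classical
  have : degIn G U v ≤ #(U.erase v) := by
    refine card_le_card fun w hw => ?_
    simp only [mem_filter] at hw
    exact mem_erase.2 ⟨hw.2.ne', hw.1⟩
  rw [card_erase_of_mem hv] at this
  have := card_pos.2 ⟨v, hv⟩
  omega

theorem card_le_degIn {U A : Finset V} {v : V} (hA : A ⊆ U) (h : ∀ w ∈ A, G.Adj v w) :
    #A ≤ degIn G U v :=
  card_le_card fun w hw => by simp [hA hw, h w hw]

theorem adjPairs_union_right [DecidableEq V] {B C : Finset V} (h : Disjoint B C) (A : Finset V) :
    adjPairs G A (B ∪ C) = adjPairs G A B + adjPairs G A C := by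
  simp only [adjPairs, degIn_union h, sum_add_distrib]

theorem adjPairs_union_left [DecidableEq V] {A B : Finset V} (h : Disjoint A B) (C : Finset V) :
    adjPairs G (A ∪ B) C = adjPairs G A C + adjPairs G B C := by
  simp only [adjPairs, sum_union h]

theorem adjPairs_union_self [DecidableEq V] {A B : Finset V} (h : Disjoint A B) :
    adjPairs G (A ∪ B) (A ∪ B) = adjPairs G A A + 2 * adjPairs G A B + adjPairs G B B := by
  rw [adjPairs_union_left h, adjPairs_union_right h, adjPairs_union_right h, adjPairs_comm B A]
  ring

theorem adjPairs_singleton_left (v : V) (B : Finset V) : adjPairs G {v} B = degIn G B v := by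
  simp [adjPairs]

theorem adjPairs_insert_self [DecidableEq V] {A : Finset V} {v : V} (h : v ∉ A) :
    adjPairs G (insert v A) (insert v A) = adjPairs G A A + 2 * degIn G A v := by
  rw [insert_eq, adjPairs_union_self (by simpa using h), adjPairs_singleton_left,
    adjPairs_singleton_left, degIn_singleton_self]
  ring

/-- Inclusion–exclusion: the edges avoiding U are all edges, less the degree sum over U, with the
edges inside U added back. All terms are doubled and arranged to avoid subtraction. -/
theorem adjPairs_univ [Fintype V] [DecidableEq V] (U : Finset V) :
    adjPairs G univ univ + adjPairs G U U
      = 2 * adjPairs G U univ + adjPairs G Uᶜ Uᶜ := by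
  have h1 := adjPairs_union_self (G := G) (disjoint_compl_right (a := U))
  have h2 := adjPairs_union_right (G := G) (disjoint_compl_right (a := U)) U
  rw [union_compl] at h1 h2
  omega

theorem adjPairs_eq_zero {A B : Finset V} (h : ∀ a ∈ A, ∀ b ∈ B, ¬ G.Adj a b) :
    adjPairs G A B = 0 :=
  sum_eq_zero fun a ha => degIn_eq_zero (h a ha)

theorem degIn_univ_eq [Fintype V] [DecidableRel G.Adj] (v : V) : degIn G univ v = G.degree v := by
  unfold degIn
  rw [← SimpleGraph.card_neighborFinset_eq_degree]
  congr 1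
  ext w
  simp

theorem adjPairs_univ_univ [Fintype V] : adjPairs G univ univ = 2 * G.edgeSet.ncard := by
  classical
  unfold adjPairs
  simp only [degIn_univ_eq]
  rw [SimpleGraph.sum_degrees_eq_twice_card_edges, ← SimpleGraph.coe_edgeFinset,
    Set.ncard_coe_finset]

end degreeSums

/-! ### Connected vertex sets and longest paths -/

section paths

variable {V : Type*} {G : SimpleGraph V}

/-- `P` cannot be split into two nonempty parts without edges between them. -/
def IsConnectedIn (G : SimpleGraph V) (P : Finset V) : Prop :=
  ∀ A ⊆ P, A.Nonempty → (∀ a ∈ A, ∀ b ∈ P, G.Adj a b → b ∈ A) → A = P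

/-- This is e(P) ≥ |P| - 1, doubled. Growing a set from one vertex, connectedness supplies each time
a new vertex adjacent to the set, hence a new edge. -/
theorem IsConnectedIn.two_mul_card_le {P : Finset V} (hP : IsConnectedIn G P) (hne : P.Nonempty) :
    2 * #P ≤ adjPairs G P P + 2 := by
  classical
  have key : ∀ m, 1 ≤ m → m ≤ #P → ∃ A ⊆ P, #A = m ∧ 2 * m ≤ adjPairs G A A + 2 := by
    intro m hm
    induction m, hm using Nat.le_induction with
    | base =>
      intro _
      obtain ⟨v, hv⟩ := hne
      exact ⟨{v}, by simpa using hv, by simp, by omega⟩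
    | succ m hm ih =>
      intro hmP
      obtain ⟨A, hAP, hA, hAm⟩ := ih (by omega)
      have hAne : A.Nonempty := card_pos.1 (by omega)
      have : ∃ a ∈ A, ∃ b ∈ P, G.Adj a b ∧ b ∉ A := by
        by_contra! hcon
        have := hP A hAP hAne hcon
        subst this
        omega
      obtain ⟨a, ha, b, hb, hab, hbA⟩ := this
      refine ⟨insert b A, insert_subset hb hAP, by rw [card_insert_of_notMem hbA, hA], ?_⟩
      rw [adjPairs_insert_self hbA]
      have := degIn_pos ha hab.symm
      omega
  obtain ⟨A, hAP, hA, hAm⟩ := key _ (card_pos.2 hne) le_rfl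
  rwa [eq_of_subset_of_card_le hAP hA.ge] at hAm

/-- `f 0, …, f k` is a path in `P`. -/
structure IsPathIn (G : SimpleGraph V) (P : Finset V) (f : ℕ → V) (k : ℕ) : Prop where
  mem : ∀ i ≤ k, f i ∈ P
  inj : ∀ i ≤ k, ∀ j ≤ k, f i = f j → i = j
  adj : ∀ i < k, G.Adj (f i) (f (i + 1))

theorem IsPathIn.card_lt {P : Finset V} {f : ℕ → V} {k : ℕ} (h : IsPathIn G P f k) : k < #P := by
  have := card_le_card_of_injOn f (s := range (k + 1)) (t := P)
    (fun i hi => h.mem i (by simpa [Nat.lt_succ_iff] using hi))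
    (fun i hi j hj hij => h.inj i (by simpa [Nat.lt_succ_iff] using hi) j
      (by simpa [Nat.lt_succ_iff] using hj) hij)
  simpa using this

theorem IsPathIn.reverse {P : Finset V} {f : ℕ → V} {k : ℕ} (h : IsPathIn G P f k) :
    IsPathIn G P (fun i => f (k - i)) k where
  mem i hi := h.mem _ (by omega)
  inj i hi j hj hij := by
    have := h.inj _ (by omega) _ (by omega) hij
    omega
  adj i hi := by
    have := h.adj (k - (i + 1)) (by omega)
    rw [show k - (i + 1) + 1 = k - i by omega] at this
    exact this.symm

theorem IsPathIn.cons {P : Finset V} {f : ℕ → V} {k : ℕ} (h : IsPathIn G P f k) {w : V}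
    (hw : w ∈ P) (hadj : G.Adj w (f 0)) (hne : ∀ i ≤ k, f i ≠ w) :
    IsPathIn G P (fun i => Nat.casesOn i w f) (k + 1) where
  mem i hi := by
    rcases i with _ | i
    · exact hw
    · exact h.mem i (by omega)
  inj i hi j hj hij := by
    rcases i with _ | i <;> rcases j with _ | j
    · rfl
    · exact absurd hij.symm (hne j (by omega))
    · exact absurd hij (hne i (by omega))
    · rw [h.inj i (by omega) j (by omega) hij]
  adj i hi := by
    rcases i with _ | i
    · exact hadj
    · exact h.adj i (by omega)

/-- A connected set of vertices with all inner degrees at most two is spanned by a path, and an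
adjacency that does not belong to the path joins its two ends. -/
theorem IsConnectedIn.exists_path {P : Finset V} (hP : IsConnectedIn G P) (hne : P.Nonempty)
    (hdeg : ∀ v ∈ P, degIn G P v ≤ 2) :
    ∃ f : ℕ → V, ∃ k, IsPathIn G P f k ∧ #P = k + 1 ∧ (∀ v ∈ P, ∃ i ≤ k, f i = v) ∧
      ∀ i j, i < j → j ≤ k → G.Adj (f i) (f j) → j = i + 1 ∨ (i = 0 ∧ j = k) := by
  classical
  have hex : ∃ k, ∃ f, IsPathIn G P f k := by
    obtain ⟨v, hv⟩ := hne
    exact ⟨0, fun _ => v, fun _ _ => hv, fun i hi j hj _ => by omega, fun i hi => by omega⟩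
  let k := Nat.findGreatest (fun k => ∃ f, IsPathIn G P f k) #P
  have hk : ∃ f, IsPathIn G P f k := by
    obtain ⟨m, f, hf⟩ := hex
    exact Nat.findGreatest_spec (P := fun k => ∃ f, IsPathIn G P f k) hf.card_lt.le ⟨f, hf⟩
  have hmax : ∀ g, ¬ IsPathIn G P g (k + 1) := by
    intro g hg
    have : k + 1 ≤ k := Nat.le_findGreatest (P := fun k => ∃ f, IsPathIn G P f k)
      hg.card_lt.le ⟨g, hg⟩
    omega
  obtain ⟨f, hf⟩ := hk
  -- By maximality of k, a neighbour of the first vertex cannot lie off the path. The claim covers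
  -- every path of length k so that it also applies to the reversal of f, that is, to the last
  -- vertex.
  have hfirst : ∀ g, IsPathIn G P g k → ∀ w ∈ P, G.Adj (g 0) w → ∃ i ≤ k, g i = w := by
    intro g hg w hw hadj
    by_contra! hcon
    exact hmax _ (hg.cons hw hadj.symm hcon)
  have hinner : ∀ i, 0 < i → i < k → ∀ w ∈ P, G.Adj (f i) w → w = f (i - 1) ∨ w = f (i + 1) := by
    intro i hi hik w hw hadj
    by_contra! hcon
    have h1 := hf.adj (i - 1) (by omega)
    rw [Nat.sub_add_cancel hi] at h1
    have h2 := hf.adj i hik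
    have hne : f (i - 1) ≠ f (i + 1) := fun h => by
      have := hf.inj _ (by omega) _ (by omega) h
      omega
    have h3 : #{f (i - 1), f (i + 1), w} ≤ degIn G P (f i) := by
      apply card_le_degIn
      · intro z hz
        simp only [mem_insert, mem_singleton] at hz
        rcases hz with rfl | rfl | rfl
        · exact hf.mem _ (by omega)
        · exact hf.mem _ (by omega)
        · exact hw
      · intro z hz
        simp only [mem_insert, mem_singleton] at hz
        rcases hz with rfl | rfl | rfl
        · exact h1.symm
        · exact h2
        · exact hadj
    rw [card_eq_three.2 ⟨_, _, _, hne, hcon.1.symm, hcon.2.symm, rfl⟩] at h3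
    have := hdeg _ (hf.mem i hik.le)
    omega
  -- The ends have no neighbours off the path by maximality, inner vertices none by the degree
  -- bound; so the path is closed under adjacency in P and, by connectedness, equals P.
  have hcover : (range (k + 1)).image f = P := by
    apply hP
    · intro v hv
      obtain ⟨i, hi, rfl⟩ := mem_image.1 hv
      exact hf.mem i (by simpa [Nat.lt_succ_iff] using hi)
    · exact ⟨f 0, mem_image_of_mem _ (by simp)⟩
    · intro a ha b hb hab
      obtain ⟨i, hi, rfl⟩ := mem_image.1 ha
      have hi : i ≤ k := by simpa [Nat.lt_succ_iff] using hi
      suffices ∃ j ≤ k, f j = b by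
        obtain ⟨j, hj, rfl⟩ := this
        exact mem_image_of_mem _ (by simpa [Nat.lt_succ_iff] using hj)
      rcases Nat.eq_zero_or_pos i with rfl | hpos
      · exact hfirst f hf b hb hab
      rcases hi.lt_or_eq with hik | rfl
      · rcases hinner i hpos hik b hb hab with rfl | rfl
        · exact ⟨_, by omega, rfl⟩
        · exact ⟨_, by omega, rfl⟩
      · obtain ⟨j, hj, h⟩ := hfirst _ hf.reverse b hb (by simpa using hab)
        exact ⟨_, by omega, h⟩
  refine ⟨f, k, hf, ?_, ?_, ?_⟩
  · rw [← hcover, card_image_of_injOn, card_range]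
    intro i hi j hj hij
    exact hf.inj i (by simpa [Nat.lt_succ_iff] using hi) j (by simpa [Nat.lt_succ_iff] using hj) hij
  · intro v hv
    rw [← hcover] at hv
    obtain ⟨i, hi, rfl⟩ := mem_image.1 hv
    exact ⟨i, by simpa [Nat.lt_succ_iff] using hi, rfl⟩
  · intro i j hij hjk hadj
    rcases Nat.eq_zero_or_pos i with rfl | hpos
    · rcases hjk.lt_or_eq with hjk | rfl
      · rcases hinner j hij hjk _ (hf.mem _ (by omega)) hadj.symm with h | h
        · have := hf.inj _ (by omega) _ (by omega) h
          omega
        · have := hf.inj _ (by omega) _ (by omega) h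
          omega
      · exact Or.inr ⟨rfl, rfl⟩
    · rcases hinner i hpos (by omega) _ (hf.mem _ (by omega)) hadj with h | h
      · have := hf.inj _ (by omega) _ (by omega) h
        omega
      · have := hf.inj _ (by omega) _ (by omega) h
        omega

end paths

/-! ### Edge bounds and the structure of the cubic vertices -/

section critical

variable {V : Type*} [Fintype V] {G : SimpleGraph V}

/-- A graph with `2 |G| - 2` edges all of whose proper induced subgraphs, and all of whose
subgraphs missing one edge, have a vertex of degree at most two, in terms of `degIn`. -/
structure IsTight (G : SimpleGraph V) : Prop where
  exists_degIn_le_two : ∀ U : Finset V, U ≠ univ → U.Nonempty → ∃ v ∈ U, degIn G U v ≤ 2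
  degIn_le_three : ∀ a b, G.Adj a b → degIn G univ a ≤ 3 ∨ degIn G univ b ≤ 3
  sum_eq : adjPairs G univ univ + 4 = 4 * Fintype.card V
  three_le_degIn : ∀ v, 3 ≤ degIn G univ v

/-- Removing a vertex of degree at most two costs at most two edges, and the last two vertices span
at most one edge; hence e(U) ≤ 2|U| - 3, here doubled. -/
theorem adjPairs_self_le
    (hlow : ∀ U : Finset V, U ≠ univ → U.Nonempty → ∃ v ∈ U, degIn G U v ≤ 2)
    (U : Finset V) (hU : U ≠ univ) (hcard : 2 ≤ #U) : adjPairs G U U + 6 ≤ 4 * #U := by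
  classical
  obtain ⟨k, hk⟩ : ∃ k, #U = k := ⟨_, rfl⟩
  rw [hk] at hcard ⊢
  induction k, hcard using Nat.le_induction generalizing U with
  | base =>
    obtain ⟨a, b, hab, rfl⟩ := card_eq_two.1 hk
    rw [adjPairs_insert_self (by simpa using hab)]
    have := degIn_singleton_le (G := G) a b
    simp only [adjPairs_singleton_left, degIn_singleton_self]
    omega
  | succ m hm2 ih =>
    obtain ⟨v, hv, hdeg⟩ := hlow U hU (card_pos.1 (by omega))
    have h1 := ih (U.erase v) (fun h => by
      have := mem_univ v
      rw [← h] at this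
      simp at this) (by rw [card_erase_of_mem hv]; omega)
    have h2 := adjPairs_insert_self (G := G) (notMem_erase v U)
    rw [insert_erase hv] at h2
    have h3 := degIn_mono (G := G) (erase_subset v U) v
    omega

/-- Without a vertex of degree at most two, at least 2(n - 1) - 2 edges would remain on n - 1
vertices, one too many for `adjPairs_self_le`. For n = 2 that bound does not apply to the single
remaining vertex, but two vertices cannot span two edges. -/
theorem three_le_degIn_of_card
    (hlow : ∀ U : Finset V, U ≠ univ → U.Nonempty → ∃ v ∈ U, degIn G U v ≤ 2)
    (hsum : adjPairs G univ univ + 4 = 4 * Fintype.card V) (hV : 2 ≤ Fintype.card V) (v : V) :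
    3 ≤ degIn G univ v := by
  classical
  have h2 := adjPairs_insert_self (G := G) (notMem_erase v univ)
  rw [insert_erase (mem_univ v)] at h2
  have h3 := degIn_mono (G := G) (erase_subset v univ) v
  have hc : #(univ.erase v) = Fintype.card V - 1 := by
    rw [card_erase_of_mem (mem_univ v), card_univ]
  by_cases hn : Fintype.card V = 2
  · rw [hn] at hc
    obtain ⟨w, hw⟩ := card_eq_one.1 hc
    have := degIn_singleton_le (G := G) v w
    rw [hw, adjPairs_singleton_left, degIn_singleton_self] at h2
    omega
  · have := adjPairs_self_le hlow (univ.erase v) (fun h => by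
      have := mem_univ v
      rw [← h] at this
      simp at this) (by omega)
    omega

namespace IsTight

open Classical in
/-- The vertices of degree three. -/
noncomputable def cubic (G : SimpleGraph V) : Finset V := {v | degIn G univ v = 3}

theorem mem_cubic {v : V} : v ∈ cubic G ↔ degIn G univ v = 3 := by
  classical
  simp [cubic]

/-- The subgraph of the edges between vertices of degree three. -/
def cubicGraph (G : SimpleGraph V) : SimpleGraph V where
  Adj a b := G.Adj a b ∧ a ∈ cubic G ∧ b ∈ cubic G
  symm := ⟨fun _ _ h => ⟨h.1.symm, h.2.2, h.2.1⟩⟩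
  loopless := ⟨fun _ h => G.irrefl h.1⟩

open Classical in
/-- The vertices of degree three in a connected component of `cubicGraph`. -/
noncomputable def part (G : SimpleGraph V) (c : (cubicGraph G).ConnectedComponent) : Finset V :=
  {v ∈ cubic G | (cubicGraph G).connectedComponentMk v = c}

open Classical in
/-- The connected components of `cubicGraph` that contain a vertex of degree three. -/
noncomputable def parts (G : SimpleGraph V) : Finset (cubicGraph G).ConnectedComponent :=
  (cubic G).image (cubicGraph G).connectedComponentMk

theorem mem_part {c : (cubicGraph G).ConnectedComponent} {v : V} :
    v ∈ part G c ↔ v ∈ cubic G ∧ (cubicGraph G).connectedComponentMk v = c := by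
  classical
  simp [part]

theorem part_subset (c : (cubicGraph G).ConnectedComponent) : part G c ⊆ cubic G :=
  fun _ hv => (mem_part.1 hv).1

theorem part_nonempty {c : (cubicGraph G).ConnectedComponent} (hc : c ∈ parts G) :
    (part G c).Nonempty := by
  classical
  obtain ⟨v, hv, rfl⟩ := mem_image.1 hc
  exact ⟨v, mem_part.2 ⟨hv, rfl⟩⟩

theorem part_closed {c : (cubicGraph G).ConnectedComponent} {v w : V} (hv : v ∈ part G c)
    (hw : w ∈ cubic G) (h : G.Adj v w) : w ∈ part G c := by
  rw [mem_part] at hv ⊢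
  refine ⟨hw, ?_⟩
  rw [← hv.2, SimpleGraph.ConnectedComponent.eq]
  exact SimpleGraph.Adj.reachable ⟨h.symm, hw, hv.1⟩

theorem part_disjoint {c d : (cubicGraph G).ConnectedComponent} (h : c ≠ d) :
    Disjoint (part G c) (part G d) := by
  rw [disjoint_left]
  intro v hv hw
  exact h ((mem_part.1 hv).2.symm.trans (mem_part.1 hw).2)

theorem part_isConnectedIn (c : (cubicGraph G).ConnectedComponent) :
    IsConnectedIn G (part G c) := by
  intro A hA ⟨a, ha⟩ hcl
  refine Subset.antisymm hA fun b hb => ?_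
  have hr : (cubicGraph G).Reachable a b := by
    rw [← SimpleGraph.ConnectedComponent.eq, (mem_part.1 (hA ha)).2, (mem_part.1 hb).2]
  obtain ⟨p⟩ := hr
  have key : ∀ {x y : V}, (cubicGraph G).Walk x y → x ∈ A → y ∈ A := by
    intro x y p
    induction p with
    | nil => exact id
    | cons h _ ih => exact fun hx => ih (hcl _ hx _ (part_closed (hA hx) h.2.2 h.1) h.1)
  exact key p ha

theorem two_mul_card_part_le {c : (cubicGraph G).ConnectedComponent} (hc : c ∈ parts G) :
    2 * #(part G c) ≤ adjPairs G (part G c) (part G c) + 2 :=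
  (part_isConnectedIn c).two_mul_card_le (part_nonempty hc)

theorem adjPairs_cubic_univ {U : Finset V} (hU : U ⊆ cubic G) :
    adjPairs G U univ = 3 * #U := by
  unfold adjPairs
  rw [sum_congr rfl fun v hv => mem_cubic.1 (hU hv)]
  simp [mul_comm]

/-- The part meets 3|P| - e(P) edges, and the others lie in its complement, where `adjPairs_self_le`
applies. This gives e(P) ≤ |P| - 1, so with `two_mul_card_part_le` the part is a tree. -/
theorem adjPairs_part_le (hG : IsTight G) [DecidableEq V] {c : (cubicGraph G).ConnectedComponent}
    (hc : c ∈ parts G) (h2 : 2 ≤ #(part G c)ᶜ) :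
    adjPairs G (part G c) (part G c) + 2 ≤ 2 * #(part G c) := by
  have h1 := adjPairs_univ (G := G) (part G c)
  rw [adjPairs_cubic_univ (part_subset c)] at h1
  have h3 := adjPairs_self_le hG.exists_degIn_le_two (part G c)ᶜ
    (fun h => (part_nonempty hc).ne_empty (by simpa using h)) h2
  have h4 := hG.sum_eq
  have h5 := card_add_card_compl (part G c)
  omega

theorem not_adj_of_notMem (hG : IsTight G) {a b : V} (ha : a ∉ cubic G) (hb : b ∉ cubic G) :
    ¬ G.Adj a b := by
  intro h
  have h1 := hG.three_le_degIn a
  have h2 := hG.three_le_degIn b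
  rw [mem_cubic] at ha hb
  have := hG.degIn_le_three a b h
  omega

theorem sum_card_parts : ∑ c ∈ parts G, #(part G c) = #(cubic G) := by
  classical
  rw [card_eq_sum_card_image (cubicGraph G).connectedComponentMk]
  rfl

theorem adjPairs_cubic : ∑ c ∈ parts G, adjPairs G (part G c) (part G c)
    = adjPairs G (cubic G) (cubic G) := by
  classical
  unfold adjPairs
  rw [← sum_fiberwise_of_maps_to (s := cubic G) (t := parts G)
    (g := (cubicGraph G).connectedComponentMk) (fun v hv => mem_image_of_mem _ hv)]
  refine sum_congr rfl fun c hc => sum_congr rfl fun v hv => ?_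
  change v ∈ part G c at hv
  unfold degIn
  congr 1
  ext w
  simp only [mem_filter]
  exact ⟨fun h => ⟨part_subset c h.1, h.2⟩, fun h => ⟨part_closed hv h.1 h.2, h.2⟩⟩

/-- The cubic vertices S induce a forest with p trees, so |S| - p edges. As T is independent, every
edge meets S, and 2n - 2 = 3|S| - (|S| - p). -/
theorem card_parts (hG : IsTight G) [DecidableEq V]
    (h2 : ∀ c ∈ parts G, 2 ≤ #(part G c)ᶜ) : #(parts G) + 2 = 2 * #(cubic G)ᶜ := by
  have h1 : ∑ c ∈ parts G, (adjPairs G (part G c) (part G c) + 2)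
      = ∑ c ∈ parts G, 2 * #(part G c) :=
    sum_congr rfl fun c hc =>
      le_antisymm (hG.adjPairs_part_le hc (h2 c hc)) (two_mul_card_part_le hc)
  rw [sum_add_distrib, adjPairs_cubic, ← mul_sum, sum_card_parts, sum_const, smul_eq_mul] at h1
  have h3 := adjPairs_univ (G := G) (cubic G)
  rw [adjPairs_cubic_univ subset_rfl, adjPairs_eq_zero (A := (cubic G)ᶜ) fun a ha b hb =>
    hG.not_adj_of_notMem (mem_compl.1 ha) (mem_compl.1 hb)] at h3
  have h4 := hG.sum_eq
  have h5 := card_add_card_compl (cubic G)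
  omega

/-- A cubic vertex outside the part has no neighbour in it and so keeps degree three when the part
is deleted; the vertex of low degree is therefore not cubic. -/
theorem exists_degIn_compl_part_le (hG : IsTight G) [DecidableEq V]
    {c : (cubicGraph G).ConnectedComponent} (hc : c ∈ parts G) (h2 : 2 ≤ #(part G c)ᶜ) :
    ∃ t ∈ (cubic G)ᶜ, degIn G (part G c)ᶜ t ≤ 2 := by
  obtain ⟨t, ht, hdeg⟩ := hG.exists_degIn_le_two (part G c)ᶜ
    (fun h => (part_nonempty hc).ne_empty (by simpa using h)) (card_pos.1 (by omega))
  refine ⟨t, mem_compl.2 fun hS => ?_, hdeg⟩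
  have h0 : degIn G (part G c) t = 0 := degIn_eq_zero fun w hw h =>
    mem_compl.1 ht (part_closed hw hS h.symm)
  have h1 := degIn_union (G := G) (disjoint_compl_right (a := part G c)) t
  rw [union_compl, mem_cubic.1 hS] at h1
  omega

theorem card_compl_cubic_le_two (hG : IsTight G) [DecidableEq V]
    {c d : (cubicGraph G).ConnectedComponent} (hc : c ∈ parts G) (hd : d ∈ parts G) (hcd : c ≠ d)
    (h2 : ∀ c ∈ parts G, 2 ≤ #(part G c)ᶜ) {t : V} (ht : t ∈ (cubic G)ᶜ)
    (htc : degIn G (part G c)ᶜ t ≤ 2) (htd : degIn G (part G d)ᶜ t ≤ 2) :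
    #(cubic G)ᶜ ≤ 2 := by
  have hdis := part_disjoint hcd
  have htS := mem_compl.1 ht
  have h1 := degIn_union (G := G) (disjoint_compl_right (a := part G c)) t
  have h1' := degIn_union (G := G) (disjoint_compl_right (a := part G d)) t
  rw [union_compl] at h1 h1'
  have h3 := degIn_mono (G := G) (le_compl_iff_disjoint_right.2 hdis) t
  have h4 := degIn_mono (G := G) (le_compl_iff_disjoint_right.2 hdis.symm) t
  have h5 := hG.three_le_degIn t
  rw [mem_cubic] at htS
  have htn : t ∉ part G c ∪ part G d := fun h => by
    rcases mem_union.1 h with h | h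
    · exact htS (mem_cubic.1 (part_subset _ h))
    · exact htS (mem_cubic.1 (part_subset _ h))
  have hU := adjPairs_insert_self (G := G) htn
  rw [adjPairs_union_self hdis, degIn_union hdis, adjPairs_eq_zero (A := part G c) (B := part G d)
    fun a ha b hb h => disjoint_left.1 hdis (part_closed ha (part_subset _ hb) h) hb] at hU
  have h6 := hG.adjPairs_part_le hc (h2 c hc)
  have h7 := hG.adjPairs_part_le hd (h2 d hd)
  have h8 := two_mul_card_part_le hc
  have h9 := two_mul_card_part_le hd
  have hT := adjPairs_univ (G := G) (insert t (part G c ∪ part G d))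
  have hUu : adjPairs G (insert t (part G c ∪ part G d)) univ
      = degIn G univ t + 3 * #(part G c ∪ part G d) := by
    rw [← adjPairs_cubic_univ (union_subset (part_subset c) (part_subset d))]
    exact sum_insert htn
  rw [card_union_of_disjoint hdis] at hUu
  have hcard := card_insert_of_notMem htn
  rw [card_union_of_disjoint hdis] at hcard
  have hcompl := card_add_card_compl (insert t (part G c ∪ part G d))
  have hs := hG.sum_eq
  -- The vertex t has degree at least four and at most two neighbours outside each part, hence
  -- exactly two in each part and none elsewhere. Both parts being trees, the complement of this set
  -- U spans 2|Uᶜ| - 2 edges, too many once |Uᶜ| ≥ 2.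
  have hle : #(insert t (part G c ∪ part G d))ᶜ ≤ 1 := by
    by_contra! hlt
    have := adjPairs_self_le hG.exists_degIn_le_two _
      (fun h => (insert_ne_empty t (part G c ∪ part G d)) (compl_eq_top.1 h)) hlt
    omega
  have hsub : (cubic G)ᶜ ⊆ insert t (insert t (part G c ∪ part G d))ᶜ := by
    intro v hv
    by_cases hvt : v = t
    · simp [hvt]
    · refine mem_insert_of_mem (mem_compl.2 fun h => ?_)
      rcases mem_insert.1 h with h | h
      · exact hvt h
      · exact mem_compl.1 hv (union_subset (part_subset c) (part_subset d) h)
  have := card_le_card hsub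
  have := card_insert_le t (insert t (part G c ∪ part G d))ᶜ
  omega

theorem card_compl_cubic (hG : IsTight G) (hV : 2 ≤ Fintype.card V) [DecidableEq V]
    (h2 : ∀ c ∈ parts G, 2 ≤ #(part G c)ᶜ) : #(cubic G)ᶜ = 2 := by
  have hp := hG.card_parts h2
  have hle : #(cubic G)ᶜ ≤ 2 := by
    by_contra! hlt
    have : Nonempty V := Fintype.card_pos_iff.1 (by omega)
    choose! t ht htc using fun c (hc : c ∈ parts G) => hG.exists_degIn_compl_part_le hc (h2 c hc)
    -- Pigeonhole: 2|T| - 2 > |T| as soon as |T| ≥ 3.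
    obtain ⟨c, hc, d, hd, hcd, heq⟩ := exists_ne_map_eq_of_card_lt_of_maps_to
      (s := parts G) (t := (cubic G)ᶜ) (by omega) ht
    have := hG.card_compl_cubic_le_two hc hd hcd h2 (ht c hc) (htc c hc) (heq ▸ htc d hd)
    omega
  have h1 : #(cubic G)ᶜ ≠ 1 := by
    intro h1
    have h0 : #(parts G) = 0 := by omega
    have hS : cubic G = ∅ := by
      classical
      simpa [parts] using h0
    have := card_add_card_compl (cubic G)
    rw [h1, hS] at this
    simp at this
    omega
  omega

end IsTight

end critical

/-! ### Recognizing wheels -/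

section wheels

variable {V : Type*} {G : SimpleGraph V}

theorem adj_of_degIn_eq_card {U : Finset V} {v w : V} (h : degIn G U v = #U) (hw : w ∈ U) :
    G.Adj v w := by
  classical
  unfold degIn at h
  rw [card_filter_eq_iff] at h
  exact h w hw

theorem adj_of_degIn_add_one_eq_card {U : Finset V} {v w : V} (hv : v ∈ U)
    (h : degIn G U v + 1 = #U) (hw : w ∈ U) (hwv : w ≠ v) : G.Adj v w := by
  classical
  refine adj_of_degIn_eq_card (U := U.erase v) ?_ (mem_erase.2 ⟨hwv, hw⟩)
  have := degIn_union (G := G) (A := {v}) (B := U.erase v) (by simp) v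
  rw [degIn_singleton_self, ← insert_eq, insert_erase hv] at this
  rw [card_erase_of_mem hv]
  omega

theorem cycleGraph_adj_iff_of_lt {k : ℕ} {i j : Fin (k + 1)} (hij : i < j) :
    (SimpleGraph.cycleGraph (k + 1)).Adj i j ↔
      (j : ℕ) = i + 1 ∨ ((i : ℕ) = 0 ∧ (j : ℕ) = k) := by
  rw [SimpleGraph.cycleGraph_adj', Fin.sub_val_of_le hij.le, Fin.coe_sub_iff_lt.2 hij]
  have := j.2
  have : (i : ℕ) < j := hij
  omega

/-- A graph is a wheel if a Hamiltonian cycle of a vertex-deleted subgraph carries all of its edges,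
and the remaining vertex is adjacent to all others. -/
theorem isWheel_of_path {P : Finset V} {z : V} (hz : z ∉ P) (hP : ∀ v, v = z ∨ v ∈ P) {f : ℕ → V}
    {k : ℕ} (hk : 2 ≤ k) (hf : IsPathIn G P f k) (hcov : ∀ v ∈ P, ∃ i ≤ k, f i = v)
    (hadj : ∀ i j, i < j → j ≤ k → G.Adj (f i) (f j) → j = i + 1 ∨ (i = 0 ∧ j = k))
    (hends : G.Adj (f 0) (f k)) (hhub : ∀ v ∈ P, G.Adj z v) : IsWheel G := by
  refine ⟨k + 1, by omega, ⟨SimpleGraph.Iso.symm ?_⟩⟩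
  let e : Option (Fin (k + 1)) → V := fun o => o.elim z fun i => f i
  have hmem : ∀ i : Fin (k + 1), f i ∈ P := fun i => hf.mem _ (by omega)
  have he : Function.Bijective e := by
    constructor
    · rintro (_ | i) (_ | j) h
      · rfl
      · exact absurd (show z ∈ P from (show z = f j from h) ▸ hmem j) hz
      · exact absurd (show z ∈ P from (show f i = z from h) ▸ hmem i) hz
      · rw [Fin.ext (hf.inj _ (by omega) _ (by omega) h)]
    · intro v
      rcases hP v with rfl | hv
      · exact ⟨none, rfl⟩
      · obtain ⟨i, hi, rfl⟩ := hcov v hv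
        exact ⟨some ⟨i, by omega⟩, rfl⟩
  have hlt : ∀ i j : Fin (k + 1), i < j →
      (G.Adj (f i) (f j) ↔ (SimpleGraph.cycleGraph (k + 1)).Adj i j) := by
    intro i j hij
    rw [cycleGraph_adj_iff_of_lt hij]
    refine ⟨hadj _ _ hij (by omega), ?_⟩
    rintro (h | ⟨h0, h1⟩)
    · rw [h]
      exact hf.adj _ (by omega)
    · rw [h0, h1]
      exact hends
  refine ⟨Equiv.ofBijective e he, ?_⟩
  rintro (_ | i) (_ | j)
  · exact iff_of_false (G.irrefl) id
  · exact iff_of_true (hhub _ (hmem j)) trivial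
  · exact iff_of_true (hhub _ (hmem i)).symm trivial
  · change G.Adj (f i) (f j) ↔ (SimpleGraph.cycleGraph (k + 1)).Adj i j
    rcases lt_trichotomy i j with h | rfl | h
    · exact hlt i j h
    · simp
    · rw [G.adj_comm, hlt j i h, SimpleGraph.adj_comm]

theorem isWheel_of_complete [Fintype V] (hV : Fintype.card V = 4)
    (h : ∀ a b, a ≠ b → G.Adj a b) : IsWheel G := by
  refine ⟨3, le_rfl, ⟨?_⟩⟩
  have hW : ∀ a b : Option (Fin 3), a ≠ b → (wheelGraph 3).Adj a b := by
    rintro (_ | i) (_ | j) hab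
    · exact absurd rfl hab
    · trivial
    · trivial
    · change (SimpleGraph.cycleGraph 3).Adj i j
      have : i ≠ j := fun h => hab (by rw [h])
      revert i j
      decide
  refine ⟨Fintype.equivOfCardEq (by simp [hV]), fun {a b} => ⟨fun hab => h a b ?_, fun hab => ?_⟩⟩
  · rintro rfl
    exact (wheelGraph 3).irrefl hab
  · exact hW _ _ fun heq => hab.ne (Equiv.injective _ heq)

/-- If all vertices are cubic, then 3n = 4n - 4, so n = 4 and G is complete. If only z is left out,
the degree sums give z degree n - 1; then P is connected and 2-regular, a cycle. -/
theorem IsTight.isWheel_of_card_compl_le [Fintype V] [DecidableEq V] (hG : IsTight G)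
    {c : (IsTight.cubicGraph G).ConnectedComponent} (hc : c ∈ IsTight.parts G)
    (h1 : #(IsTight.part G c)ᶜ ≤ 1) : IsWheel G := by
  have hsub := IsTight.part_subset c
  have hu := IsTight.adjPairs_cubic_univ hsub
  have hconn := IsTight.part_isConnectedIn c
  have hne := IsTight.part_nonempty hc
  have hs := hG.sum_eq
  have hcc := card_add_card_compl (IsTight.part G c)
  have h3 : ∀ v ∈ IsTight.part G c, degIn G univ v = 3 := fun v hv => IsTight.mem_cubic.1 (hsub hv)
  generalize IsTight.part G c = P at *
  rcases Nat.le_one_iff_eq_zero_or_eq_one.1 h1 with h0 | h0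
  · obtain rfl : P = univ := by simpa using h0
    rw [card_univ] at hu
    refine isWheel_of_complete (by omega) fun a b hab => ?_
    refine adj_of_degIn_add_one_eq_card (mem_univ a) ?_ (mem_univ b) hab.symm
    rw [h3 a (mem_univ a), card_univ]
    omega
  · obtain ⟨z, hz⟩ := card_eq_one.1 h0
    have hzP : z ∉ P := mem_compl.1 (hz ▸ mem_singleton_self z)
    have huniv : P ∪ {z} = univ := by rw [← hz, union_compl]
    have hdis : Disjoint P {z} := by simpa using hzP
    have e1 := adjPairs_union_self (G := G) hdis
    have e2 := adjPairs_union_right (G := G) hdis P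
    rw [huniv] at e1 e2
    rw [adjPairs_comm P {z}, adjPairs_singleton_left] at e1 e2
    rw [adjPairs_singleton_left, degIn_singleton_self] at e1
    have hhub : ∀ v ∈ P, G.Adj z v := fun v hv => adj_of_degIn_eq_card (U := P) (by omega) hv
    have hd : ∀ v ∈ P, degIn G P v = 2 := by
      intro v hv
      have e3 := degIn_union (G := G) hdis v
      rw [huniv, h3 v hv, degIn_singleton_of_adj (hhub v hv).symm] at e3
      omega
    obtain ⟨f, k, hf, hk, hcov, hadj⟩ := hconn.exists_path hne fun v hv => (hd v hv).le
    have hk2 : 2 ≤ k := by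
      obtain ⟨v, hv⟩ := hne
      have := degIn_add_one_le_card (G := G) hv
      rw [hd v hv] at this
      omega
    refine isWheel_of_path hzP (fun v => ?_) hk2 hf hcov hadj ?_ hhub
    · by_cases hv : v ∈ P
      · exact Or.inr hv
      · left
        rw [← mem_compl, hz] at hv
        exact mem_singleton.1 hv
    · by_contra hcon
      -- Without the closing edge, `f 1` would be the only neighbour of `f 0` in P.
      have : degIn G P (f 0) ≤ degIn G {f 1} (f 0) := by
        refine card_le_card fun w hw => ?_
        simp only [mem_filter] at hw ⊢
        refine ⟨?_, hw.2⟩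
        obtain ⟨i, hi, rfl⟩ := hcov w hw.1
        rcases Nat.eq_zero_or_pos i with rfl | hi0
        · exact absurd hw.2 G.irrefl
        rcases hadj 0 i hi0 hi hw.2 with h | h
        · simp [h]
        · exact absurd (h.2 ▸ hw.2) hcon
      have h4 := degIn_singleton_le (G := G) (f 0) (f 1)
      rw [hd _ (hf.mem 0 (by omega))] at this
      omega

end wheels

/-! ### Recognizing copies of H_n -/

section gluings

theorem HEdge.ne {n : ℕ} {a b : HVertex n} (h : HEdge n a b) : a ≠ b := by
  rcases h with ⟨i, j, h⟩ | _ | _ | _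
  · intro heq
    cases heq
    omega
  all_goals exact fun heq => HVertex.noConfusion rfl (heq_of_eq heq)

theorem HEdge.adj {n : ℕ} {a b : HVertex n} (h : HEdge n a b) : (HGraph n).Adj a b :=
  (SimpleGraph.fromRel_adj _ _ _).2 ⟨h.ne, Or.inl h⟩

variable {V : Type*} {G : SimpleGraph V}

/-- Sum over the tree Q the number of neighbours other than w. Each vertex contributes at least two,
giving at least 2|Q|; but the sum is 2|Q| - 2 plus the number of neighbours of u in Q, so at most
2|Q|. Equality throughout makes w adjacent to all of Q and u to exactly two vertices of Q. Degrees
inside Q are then at most two, so Q is a path, and its ends are the neighbours of u. -/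
theorem exists_hCopy {Q : Finset V} {u w : V} (huw : w ≠ u) (hu : u ∉ Q) (hw : w ∉ Q)
    (hconn : IsConnectedIn G Q) (hne : Q.Nonempty) (hsum : adjPairs G Q Q + 2 = 2 * #Q)
    (h3 : ∀ v ∈ Q, degIn G Q v + degIn G {u} v + degIn G {w} v = 3)
    (hnb : ∀ v ∈ Q, ∀ z, G.Adj v z → z ∈ Q ∨ z = u ∨ z = w) (hdeg : degIn G Q u ≤ 2) :
    ∃ i, 4 ≤ i ∧ ∃ f : HVertex i ↪ V, f .x = w ∧ f .y = u ∧
      (∀ a, a ∈ Set.range f ↔ a ∈ Q ∨ a = w ∨ a = u) ∧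
      ∀ a b, ((HGraph i).map f).Adj a b ↔ G.Adj a b ∧ (a ∈ Q ∨ b ∈ Q) := by
  classical
  have hsum' : ∑ v ∈ Q, (degIn G Q v + degIn G {u} v) = adjPairs G Q Q + degIn G Q u := by
    rw [sum_add_distrib, ← adjPairs_singleton_left u Q, adjPairs_comm {u} Q]
    rfl
  have hge : ∀ v ∈ Q, 2 ≤ degIn G Q v + degIn G {u} v := by
    intro v hv
    have := h3 v hv
    have := degIn_singleton_le (G := G) v w
    omega
  have hge' := card_nsmul_le_sum Q _ 2 hge
  rw [hsum', smul_eq_mul] at hge'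
  have hu2 : degIn G Q u = 2 := by omega
  have heq : ∀ v ∈ Q, degIn G Q v + degIn G {u} v = 2 := by
    have h4 : ∑ v ∈ Q, 2 = ∑ v ∈ Q, (degIn G Q v + degIn G {u} v) := by
      rw [hsum', sum_const, smul_eq_mul]
      omega
    exact fun v hv => ((sum_eq_sum_iff_of_le hge).1 h4 v hv).symm
  have hwadj : ∀ v ∈ Q, G.Adj v w := by
    intro v hv
    apply adj_of_degIn_singleton
    have := h3 v hv
    have := heq v hv
    omega
  obtain ⟨p, k, hp, hk, hcov, hadj⟩ := hconn.exists_path hne fun v hv => by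
    have := heq v hv
    omega
  have hinner : ∀ i, 0 < i → i < k → ¬ G.Adj (p i) u := by
    intro i hi hik hadju
    have h1 := hp.adj (i - 1) (by omega)
    rw [Nat.sub_add_cancel hi] at h1
    have hpne : p (i - 1) ≠ p (i + 1) := fun h => by
      have := hp.inj _ (by omega) _ (by omega) h
      omega
    have h5 : #{p (i - 1), p (i + 1)} ≤ degIn G Q (p i) := by
      apply card_le_degIn
      · intro z hz
        simp only [mem_insert, mem_singleton] at hz
        rcases hz with rfl | rfl
        · exact hp.mem _ (by omega)
        · exact hp.mem _ (by omega)
      · intro z hz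
        simp only [mem_insert, mem_singleton] at hz
        rcases hz with rfl | rfl
        · exact h1.symm
        · exact hp.adj i hik
    rw [card_pair hpne] at h5
    have := heq _ (hp.mem i hik.le)
    rw [degIn_singleton_of_adj hadju] at this
    omega
  have hends : ({v ∈ Q | G.Adj u v} : Finset V) = {p 0, p k} := by
    refine eq_of_subset_of_card_le (fun v hv => ?_) ?_
    · rw [mem_filter] at hv
      obtain ⟨i, hi, rfl⟩ := hcov v hv.1
      have : i = 0 ∨ i = k := by
        by_contra! hcon
        exact hinner i (by omega) (by omega) hv.2.symm
      rcases this with rfl | rfl <;> simp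
    · calc #{p 0, p k} ≤ 2 := card_le_two
        _ = degIn G Q u := hu2.symm
        _ ≤ _ := le_of_eq (by unfold degIn; congr)
  have hu0 : G.Adj u (p 0) := (mem_filter.1 (hends.ge (by simp : p 0 ∈ _))).2
  have huk : G.Adj u (p k) := (mem_filter.1 (hends.ge (by simp : p k ∈ _))).2
  have hk1 : 1 ≤ k := by
    have := degIn_le_card (G := G) Q u
    omega
  -- A chord joining the two ends would give `p 0` two neighbours in Q besides u.
  have hadj' : ∀ i j, i < j → j ≤ k → G.Adj (p i) (p j) → j = i + 1 := by
    intro i j hij hjk h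
    rcases hadj i j hij hjk h with h' | ⟨rfl, rfl⟩
    · exact h'
    · by_contra hcon
      have h5 : #{p 1, p j} ≤ degIn G Q (p 0) := by
        apply card_le_degIn
        · intro z hz
          simp only [mem_insert, mem_singleton] at hz
          rcases hz with rfl | rfl
          · exact hp.mem _ (by omega)
          · exact hp.mem _ (by omega)
        · intro z hz
          simp only [mem_insert, mem_singleton] at hz
          rcases hz with rfl | rfl
          · exact hp.adj 0 (by omega)
          · exact h
      rw [card_pair fun h => by
        have := hp.inj _ (by omega) _ (by omega) h
        omega] at h5
      have := heq _ (hp.mem 0 (by omega))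
      rw [degIn_singleton_of_adj hu0.symm] at this
      omega
  let f : HVertex (k + 3) → V := fun a => match a with
    | .x => w
    | .y => u
    | .v i => p i
  have hmem : ∀ i : Fin (k + 3 - 2), p i ∈ Q := fun i => hp.mem _ (by omega)
  have hf : Function.Injective f := by
    rintro (_ | _ | i) (_ | _ | j) h
    · rfl
    · exact absurd h huw
    · exact absurd ((show w = p j from h) ▸ hmem j) hw
    · exact absurd h.symm huw
    · rfl
    · exact absurd ((show u = p j from h) ▸ hmem j) hu
    · exact absurd ((show p i = w from h) ▸ hmem i) hw
    · exact absurd ((show p i = u from h) ▸ hmem i) hu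
    · rw [Fin.ext (hp.inj _ (by omega) _ (by omega) h)]
  have hto : ∀ a b, HEdge (k + 3) a b → G.Adj (f a) (f b) ∧ (f a ∈ Q ∨ f b ∈ Q) := by
    rintro _ _ (⟨i, j, h⟩ | i | ⟨i, h⟩ | ⟨i, h⟩)
    · refine ⟨?_, Or.inl (hmem i)⟩
      change G.Adj (p i) (p j)
      rw [← h]
      exact hp.adj _ (by omega)
    · exact ⟨(hwadj _ (hmem i)).symm, Or.inr (hmem i)⟩
    · refine ⟨?_, Or.inr (hmem i)⟩
      change G.Adj u (p i)
      rwa [h]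
    · refine ⟨?_, Or.inr (hmem i)⟩
      change G.Adj u (p i)
      rwa [show (i : ℕ) = k by omega]
  have hfrom : ∀ a b, G.Adj a b → a ∈ Q → ((HGraph (k + 3)).map f).Adj a b := by
    intro a b hab ha
    rw [SimpleGraph.map_adj']
    refine ⟨hab.ne, ?_⟩
    obtain ⟨i, hi, rfl⟩ := hcov a ha
    let vi : HVertex (k + 3) := .v ⟨i, by omega⟩
    rcases hnb _ ha b hab with hb | rfl | rfl
    · obtain ⟨j, hj, rfl⟩ := hcov b hb
      let vj : HVertex (k + 3) := .v ⟨j, by omega⟩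
      refine ⟨vi, vj, ?_, rfl, rfl⟩
      rcases lt_trichotomy i j with h | rfl | h
      · exact (HEdge.path _ _ (hadj' _ _ h hj hab).symm).adj
      · exact absurd hab G.irrefl
      · exact (HEdge.path _ _ (hadj' _ _ h hi hab.symm).symm).adj.symm
    · refine ⟨vi, .y, ?_, rfl, rfl⟩
      have : i = 0 ∨ i = k := by
        by_contra! hcon
        exact hinner i (by omega) (by omega) hab
      rcases this with rfl | rfl
      · exact (HEdge.y_first _ rfl).adj.symm
      · exact (HEdge.y_last _ rfl).adj.symm
    · exact ⟨vi, .x, (HEdge.x _).adj.symm, rfl, rfl⟩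
  refine ⟨k + 3, by omega, ⟨f, hf⟩, rfl, rfl, ?_, ?_⟩
  · intro a
    constructor
    · rintro ⟨(_ | _ | i), rfl⟩
      · exact Or.inr (Or.inl rfl)
      · exact Or.inr (Or.inr rfl)
      · exact Or.inl (hmem i)
    · rintro (ha | rfl | rfl)
      · obtain ⟨i, hi, rfl⟩ := hcov a ha
        exact ⟨.v ⟨i, by omega⟩, rfl⟩
      · exact ⟨.x, rfl⟩
      · exact ⟨.y, rfl⟩
  · intro a b
    constructor
    · intro h
      rw [SimpleGraph.map_adj'] at h
      obtain ⟨-, a, b, h, rfl, rfl⟩ := h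
      rcases ((SimpleGraph.fromRel_adj _ _ _).1 h).2 with h | h
      · exact hto _ _ h
      · exact ⟨(hto _ _ h).1.symm, (hto _ _ h).2.symm⟩
    · rintro ⟨hab, ha | hb⟩
      · exact hfrom a b hab ha
      · exact (hfrom b a hab.symm hb).symm

end gluings

/-! ### Critical graphs are wheels or gluings -/

section characterization

variable {V : Type*} [Fintype V] {G : SimpleGraph V}

theorem IsTight.isHGluing (hG : IsTight G) (hV : 2 ≤ Fintype.card V) [DecidableEq V]
    (h2 : ∀ c ∈ IsTight.parts G, 2 ≤ #(IsTight.part G c)ᶜ) : IsHGluing G := by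
  classical
  have hT := hG.card_compl_cubic hV h2
  have hp := hG.card_parts h2
  obtain ⟨c, d, hcd, hparts⟩ := card_eq_two.1 (show #(IsTight.parts G) = 2 by omega)
  obtain ⟨s, t, hst, hTst⟩ := card_eq_two.1 hT
  have hTmem : ∀ v, v ∉ IsTight.cubic G ↔ v = s ∨ v = t := fun v => by
    rw [← mem_compl, hTst]
    simp
  have hSmem : ∀ v, v ∈ IsTight.cubic G → v ∈ IsTight.part G c ∨ v ∈ IsTight.part G d := by
    intro v hv
    have : (IsTight.cubicGraph G).connectedComponentMk v ∈ IsTight.parts G := by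
      exact mem_image_of_mem _ hv
    rw [hparts] at this
    simp only [mem_insert, mem_singleton] at this
    exact this.imp (fun h => IsTight.mem_part.2 ⟨hv, h⟩) (fun h => IsTight.mem_part.2 ⟨hv, h⟩)
  -- The vertex u of degree at most two outside c has at most two neighbours in d, so it serves as
  -- connector y of the copy on d. The two copies choose u independently, hence the two ways of
  -- identifying connectors.
  have key : ∀ c d, c ≠ d → c ∈ IsTight.parts G → d ∈ IsTight.parts G →
      ∃ w u, ((w = s ∧ u = t) ∨ (w = t ∧ u = s)) ∧
        ∃ i, 4 ≤ i ∧ ∃ f : HVertex i ↪ V, f .x = w ∧ f .y = u ∧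
          (∀ a, a ∈ Set.range f ↔ a ∈ IsTight.part G d ∨ a = w ∨ a = u) ∧
          ∀ a b, ((HGraph i).map f).Adj a b ↔
            G.Adj a b ∧ (a ∈ IsTight.part G d ∨ b ∈ IsTight.part G d) := by
    intro c d hcd hc hd
    obtain ⟨u, hu, hdeg⟩ := hG.exists_degIn_compl_part_le hc (h2 c hc)
    obtain ⟨w, hwu⟩ : ∃ w, ((w = s ∧ u = t) ∨ (w = t ∧ u = s)) := by
      rcases (hTmem u).1 (mem_compl.1 hu) with rfl | rfl
      · exact ⟨t, Or.inr ⟨rfl, rfl⟩⟩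
      · exact ⟨s, Or.inl ⟨rfl, rfl⟩⟩
    refine ⟨w, u, hwu, ?_⟩
    have hne : w ≠ u := by
      rcases hwu with ⟨rfl, rfl⟩ | ⟨rfl, rfl⟩
      · exact hst
      · exact hst.symm
    have hTmem' : ∀ v, v ∉ IsTight.cubic G ↔ v = u ∨ v = w := by
      intro v
      rw [hTmem]
      rcases hwu with ⟨rfl, rfl⟩ | ⟨rfl, rfl⟩
      · exact or_comm
      · exact Iff.rfl
    have huQ : u ∉ IsTight.part G d := fun h =>
      (hTmem' u).2 (Or.inl rfl) (IsTight.part_subset d h)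
    have hwQ : w ∉ IsTight.part G d := fun h =>
      (hTmem' w).2 (Or.inr rfl) (IsTight.part_subset d h)
    have hnb : ∀ v ∈ IsTight.part G d, ∀ z, G.Adj v z →
        z ∈ IsTight.part G d ∨ z = u ∨ z = w := by
      intro v hv z hvz
      by_cases hz : z ∈ IsTight.cubic G
      · exact Or.inl (IsTight.part_closed hv hz hvz)
      · exact Or.inr ((hTmem' z).1 hz)
    refine exists_hCopy hne huQ hwQ (IsTight.part_isConnectedIn d) (IsTight.part_nonempty hd)
      (le_antisymm (hG.adjPairs_part_le hd (h2 d hd)) (IsTight.two_mul_card_part_le hd))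
      (fun v hv => ?_) hnb ?_
    · rw [← degIn_union (by simpa using huQ), ← degIn_union (by simpa [hne] using hwQ),
        ← IsTight.mem_cubic.1 (IsTight.part_subset d hv)]
      unfold degIn
      congr 1
      ext z
      simp only [mem_filter, mem_union, mem_singleton, mem_univ, true_and, and_iff_right_iff_imp]
      exact fun h => by simpa [or_assoc] using hnb v hv z h
    · exact (degIn_mono (le_compl_iff_disjoint_right.2 (IsTight.part_disjoint hcd).symm) u).trans
        hdeg
  have hc : c ∈ IsTight.parts G := by simp [hparts]
  have hd : d ∈ IsTight.parts G := by simp [hparts]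
  obtain ⟨w, u, hwu, i, hi, f, hfx, hfy, hfr, hfa⟩ := key c d hcd hc hd
  obtain ⟨w', u', hwu', j, hj, g, hgx, hgy, hgr, hga⟩ := key d c hcd.symm hd hc
  have hdis := disjoint_left.1 (IsTight.part_disjoint (G := G) hcd)
  have hs : ∀ e, s ∉ IsTight.part G e := fun e h =>
    (hTmem s).2 (Or.inl rfl) (IsTight.part_subset e h)
  have ht : ∀ e, t ∉ IsTight.part G e := fun e h =>
    (hTmem t).2 (Or.inr rfl) (IsTight.part_subset e h)
  refine ⟨i, j, hi, hj, f, g, ?_, ?_, ?_, ?_⟩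
  · rw [hfx, hfy, hgx, hgy]
    grind
  · ext a
    rw [Set.mem_inter_iff, hfr, hgr, hfx, hfy]
    simp only [Set.mem_insert_iff, Set.mem_singleton_iff]
    have := @hdis a
    grind
  · ext a
    rw [Set.mem_union, hfr, hgr]
    simp only [Set.mem_univ, iff_true]
    have := hTmem a
    have := hSmem a
    grind
  · ext a b
    rw [SimpleGraph.sup_adj, hfa, hga]
    constructor
    · intro hab
      by_cases ha : a ∈ IsTight.cubic G
      · rcases hSmem a ha with h | h
        · exact Or.inr ⟨hab, Or.inl h⟩
        · exact Or.inl ⟨hab, Or.inl h⟩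
      by_cases hb : b ∈ IsTight.cubic G
      · rcases hSmem b hb with h | h
        · exact Or.inr ⟨hab, Or.inr h⟩
        · exact Or.inl ⟨hab, Or.inr h⟩
      · exact absurd hab (hG.not_adj_of_notMem ha hb)
    · rintro (h | h) <;> exact h.1

theorem IsTight.isWheel_or_isHGluing (hG : IsTight G) (hV : 2 ≤ Fintype.card V) :
    IsWheel G ∨ IsHGluing G := by
  classical
  by_cases h : ∀ c ∈ IsTight.parts G, 2 ≤ #(IsTight.part G c)ᶜ
  · exact Or.inr (hG.isHGluing hV h)
  · push Not at h
    obtain ⟨c, hc, h⟩ := h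
    exact Or.inl (hG.isWheel_of_card_compl_le hc (by omega))

end characterization

/-! ### Minimum degree of subgraphs and the passage to tightness -/

section subgraphs

variable {V : Type*} {G : SimpleGraph V}

theorem coe_degree_eq_ncard (H : G.Subgraph) (v : H.verts) [Fintype (H.coe.neighborSet v)] :
    H.coe.degree v = (H.neighborSet v).ncard := by
  classical
  rw [SimpleGraph.degree, SimpleGraph.neighborFinset, ← Set.ncard_eq_toFinset_card',
    ← Set.ncard_image_of_injective _ Subtype.val_injective]
  congr 1
  ext w
  simp only [Set.mem_image, SimpleGraph.mem_neighborSet, SimpleGraph.Subgraph.coe_adj,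
    SimpleGraph.Subgraph.mem_neighborSet]
  exact ⟨fun ⟨x, hx, hxw⟩ => hxw ▸ hx, fun h => ⟨⟨w, h.snd_mem⟩, h, rfl⟩⟩

theorem three_le_minDegree_iff (H : G.Subgraph) [DecidableRel H.coe.Adj] [Fintype H.verts] :
    3 ≤ H.coe.minDegree ↔ H.verts.Nonempty ∧ ∀ v ∈ H.verts, 3 ≤ (H.neighborSet v).ncard := by
  constructor
  · intro h
    constructor
    · by_contra hne
      have : IsEmpty H.verts := by
        rw [Set.not_nonempty_iff_eq_empty] at hne
        rw [hne]
        infer_instance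
      rw [SimpleGraph.minDegree_of_subsingleton] at h
      omega
    · intro v hv
      rw [← coe_degree_eq_ncard H ⟨v, hv⟩]
      exact h.trans (SimpleGraph.minDegree_le_degree _ _)
  · rintro ⟨hne, h⟩
    have := hne.to_subtype
    refine SimpleGraph.le_minDegree_of_forall_le_degree _ _ fun v => ?_
    rw [coe_degree_eq_ncard]
    exact h v v.2

theorem ncard_neighborSet_le_deleteEdges [Fintype V] (H : G.Subgraph) (v w z : V) :
    (H.neighborSet z).ncard ≤ ((H.deleteEdges {s(v, w)}).neighborSet z).ncard + 1 := by
  obtain ⟨x, hx⟩ : ∃ x, H.neighborSet z ⊆ insert x ((H.deleteEdges {s(v, w)}).neighborSet z) := by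
    rcases eq_or_ne z v with rfl | hz
    · exact ⟨w, fun y hy => by
        simp only [Set.mem_insert_iff, SimpleGraph.Subgraph.mem_neighborSet,
          SimpleGraph.Subgraph.deleteEdges_adj, Set.mem_singleton_iff] at hy ⊢
        grind⟩
    · exact ⟨v, fun y hy => by
        simp only [Set.mem_insert_iff, SimpleGraph.Subgraph.mem_neighborSet,
          SimpleGraph.Subgraph.deleteEdges_adj, Set.mem_singleton_iff] at hy ⊢
        grind⟩
  exact (Set.ncard_le_ncard hx).trans (Set.ncard_insert_le _ _)

theorem neighborSet_deleteEdges_of_ne (H : G.Subgraph) {v w z : V} (hv : z ≠ v) (hw : z ≠ w) :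
    (H.deleteEdges {s(v, w)}).neighborSet z = H.neighborSet z := by
  ext y
  simp only [SimpleGraph.Subgraph.mem_neighborSet,
    SimpleGraph.Subgraph.deleteEdges_adj, Set.mem_singleton_iff]
  grind

/-- Take a minimal subgraph with all degrees at least three. Were they all at least four, deleting
one edge would contradict minimality. -/
theorem exists_minDegree_eq_three [Fintype V] (H : G.Subgraph) (hne : H.verts.Nonempty)
    (h : ∀ v ∈ H.verts, 3 ≤ (H.neighborSet v).ncard) :
    ∃ K ≤ H, ∀ (_ : DecidableRel K.coe.Adj) (_ : Fintype K.verts), K.coe.minDegree = 3 := by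
  let s : Set G.Subgraph :=
    {K | K ≤ H ∧ K.verts.Nonempty ∧ ∀ v ∈ K.verts, 3 ≤ (K.neighborSet v).ncard}
  have hs : s.Nonempty := ⟨H, le_rfl, hne, h⟩
  obtain ⟨K, hK⟩ := (Set.toFinite s).exists_minimal hs
  refine ⟨K, hK.1.1, fun _ _ => ?_⟩
  refine le_antisymm ?_ ((three_le_minDegree_iff K).2 hK.1.2)
  by_contra! h4
  have hdeg : ∀ v ∈ K.verts, 4 ≤ (K.neighborSet v).ncard := by
    intro v hv
    rw [← coe_degree_eq_ncard K ⟨v, hv⟩]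
    exact Nat.lt_of_lt_of_le h4 (SimpleGraph.minDegree_le_degree K.coe ⟨v, hv⟩)
  obtain ⟨v, hv⟩ := hK.1.2.1
  obtain ⟨w, hw⟩ : (K.neighborSet v).Nonempty := by
    rw [← Set.ncard_pos]
    have := hdeg v hv
    omega
  have hle : K.deleteEdges {s(v, w)} ≤ K := SimpleGraph.Subgraph.deleteEdges_le _
  have hmem : K.deleteEdges {s(v, w)} ∈ s := by
    refine ⟨hle.trans hK.1.1, ⟨v, hv⟩, fun z hz => ?_⟩
    have := hdeg z hz
    have := ncard_neighborSet_le_deleteEdges K v w z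
    omega
  have : (K.deleteEdges {s(v, w)}).Adj v w := (hK.2 hmem hle).2 hw
  simp at this

theorem NonInducedCritical.exists_ncard_le_two [Fintype V] (hG : NonInducedCritical G)
    (H : G.Subgraph) (hH : H ≠ ⊤) (hne : H.verts.Nonempty) : ∃ v ∈ H.verts, (H.neighborSet v).ncard ≤ 2 := by
  by_contra! h
  obtain ⟨K, hK, h3⟩ := exists_minDegree_eq_three H hne h
  exact hG.2 K (fun h => hH (top_le_iff.1 (h ▸ hK))) (h3 _ _)

theorem NonInducedCritical.isTight [Fintype V] (hG : NonInducedCritical G)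
    (hV : 2 ≤ Fintype.card V) : IsTight G := by
  classical
  have hsum : adjPairs G univ univ + 4 = 4 * Fintype.card V := by
    have := hG.1
    rw [adjPairs_univ_univ]
    omega
  have hlow : ∀ U : Finset V, U ≠ univ → U.Nonempty → ∃ v ∈ U, degIn G U v ≤ 2 := by
    intro U hU hne
    obtain ⟨v, hv, hdeg⟩ := hG.exists_ncard_le_two ((⊤ : G.Subgraph).induce U)
      (fun h => hU (by
        have := congrArg SimpleGraph.Subgraph.verts h
        simpa using this)) (by simpa using hne)
    have hv : v ∈ U := by simpa using hv
    refine ⟨v, hv, le_of_eq_of_le ?_ hdeg⟩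
    unfold degIn
    rw [← Set.ncard_coe_finset]
    congr 1
    ext w
    simp [hv]
  have h3 := three_le_degIn_of_card hlow hsum hV
  refine ⟨hlow, fun a b hab => ?_, hsum, h3⟩
  by_contra! h4
  obtain ⟨v, -, hdeg⟩ := hG.exists_ncard_le_two ((⊤ : G.Subgraph).deleteEdges {s(a, b)})
    (fun h => by
      have : ((⊤ : G.Subgraph).deleteEdges {s(a, b)}).Adj a b := by
        rw [h]
        exact hab
      simp at this) ⟨a, trivial⟩
  have htop : ∀ v, degIn G univ v = ((⊤ : G.Subgraph).neighborSet v).ncard := by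
    intro v
    unfold degIn
    rw [← Set.ncard_coe_finset]
    congr 1
    ext w
    simp
  -- Deleting ab lowers only the degrees of a and b, each by at most one from at least four; all
  -- other degrees stay at least three.
  have h5 := h3 v
  have h6 := ncard_neighborSet_le_deleteEdges (⊤ : G.Subgraph) a b v
  rw [← htop] at h6
  rcases eq_or_ne v a with rfl | hva
  · omega
  rcases eq_or_ne v b with rfl | hvb
  · omega
  rw [neighborSet_deleteEdges_of_ne _ hva hvb, ← htop] at hdeg
  omega

end subgraphs

/-! ### Wheels are critical -/

section converse

variable {V : Type*} {G : SimpleGraph V}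

/-- The nonempty subgraphs all of whose vertices have degree at least three. -/
def HasMinDegThree (H : G.Subgraph) : Prop :=
  H.verts.Nonempty ∧ ∀ v ∈ H.verts, 3 ≤ (H.neighborSet v).ncard

theorem nonInducedCritical_of [Fintype V] (hcard : G.edgeSet.ncard + 2 = 2 * Fintype.card V)
    (h : ∀ H : G.Subgraph, HasMinDegThree H → H = ⊤) : NonInducedCritical G := by
  classical
  refine ⟨hcard, fun H hH h3 => hH (h H ?_)⟩
  exact (three_le_minDegree_iff H).1 h3.ge

/-- The propagation principle: a vertex with at most three possible neighbours must keep all its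
edges in H. -/
theorem HasMinDegThree.adj {H : G.Subgraph} (hH : HasMinDegThree H) {v : V} (hv : v ∈ H.verts)
    {A : Finset V} (hA : #A ≤ 3) (hsub : ∀ w, G.Adj v w → w ∈ A) {w : V} (hw : G.Adj v w) :
    H.Adj v w := by
  have hle : H.neighborSet v ⊆ A := fun w hw => hsub w (H.adj_sub hw)
  have := Set.eq_of_subset_of_ncard_le hle (by
    rw [Set.ncard_coe_finset]
    exact hA.trans (hH.2 v hv)) (Finset.finite_toSet A)
  exact this.ge (hsub w hw)

theorem HasMinDegThree.exists_adj {H : G.Subgraph} (hH : HasMinDegThree H) {v : V}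
    (hv : v ∈ H.verts) (a b : V) : ∃ w, H.Adj v w ∧ w ≠ a ∧ w ≠ b := by
  by_contra! hcon
  have hsub : H.neighborSet v ⊆ {a, b} := fun w hw => by
    by_cases h : w = a
    · exact Or.inl h
    · exact Or.inr (hcon w hw h)
  have h1 := Set.ncard_le_ncard hsub (Set.toFinite _)
  have h2 := Set.ncard_insert_le a {b}
  rw [Set.ncard_singleton] at h2
  have := hH.2 v hv
  omega

theorem subgraph_eq_top {H : G.Subgraph} (hv : ∀ v, v ∈ H.verts)
    (h : ∀ a b, G.Adj a b → H.Adj a b) : H = ⊤ := by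
  ext a b
  · simp [hv a]
  · exact ⟨fun hab => H.adj_sub hab, fun hab => h a b hab⟩

open Classical in
theorem degIn_univ_eq_sum [Fintype V] (v : V) :
    degIn G univ v = ∑ w, if G.Adj v w then 1 else 0 := by
  unfold degIn
  rw [card_filter]

section wheel

theorem adjPairs_wheelGraph {m : ℕ} (hm : 3 ≤ m) :
    adjPairs (wheelGraph m) univ univ = 4 * m := by
  classical
  obtain ⟨k, rfl⟩ := Nat.exists_eq_add_of_le' hm
  unfold adjPairs
  have h0 : degIn (wheelGraph (k + 3)) univ none = k + 3 := by
    rw [degIn_univ_eq_sum, Fintype.sum_option]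
    simp [wheelGraph]
  have h1 : ∀ i, degIn (wheelGraph (k + 3)) univ (some i) = 3 := by
    intro i
    have h2 : degIn (SimpleGraph.cycleGraph (k + 3)) univ i = 2 := by
      rw [degIn_univ_eq]
      exact SimpleGraph.cycleGraph_degree_three_le
    rw [degIn_univ_eq_sum] at h2
    rw [degIn_univ_eq_sum, Fintype.sum_option]
    rw [if_pos (show (wheelGraph (k + 3)).Adj (some i) none from trivial)]
    exact congrArg (1 + ·) h2
  rw [Fintype.sum_option, h0]
  simp only [h1]
  simp
  ring

-- H has a rim vertex, since the hub alone has no neighbour. Rim vertices are cubic, so membership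
-- passes round the whole rim, and every edge of the wheel has a rim end.
open Fin.NatCast Fin.CommRing in
theorem IsWheel.nonInducedCritical [Fintype V] (hG : IsWheel G) : NonInducedCritical G := by
  classical
  obtain ⟨m, hm, ⟨φ⟩⟩ := hG
  have hcard : Fintype.card V = m + 1 := by
    rw [Fintype.card_congr φ.toEquiv]
    simp
  refine nonInducedCritical_of ?_ fun H hH => ?_
  · have h1 : G.edgeSet.ncard = (wheelGraph m).edgeSet.ncard := Nat.card_congr φ.mapEdgeSet
    have h2 := adjPairs_wheelGraph hm
    rw [adjPairs_univ_univ] at h2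
    omega
  obtain ⟨k, rfl⟩ := Nat.exists_eq_add_of_le' hm
  have hlift : ∀ a b, (wheelGraph (k + 3)).Adj a b → G.Adj (φ.symm a) (φ.symm b) :=
    fun a b h => φ.symm.map_rel_iff.2 h
  have hrim : ∀ i, φ.symm (some i) ∈ H.verts → ∀ b, G.Adj (φ.symm (some i)) b →
      H.Adj (φ.symm (some i)) b := by
    intro i hi b hb
    refine hH.adj hi (A := {φ.symm none, φ.symm (some (i + 1)), φ.symm (some (i - 1))})
      card_le_three (fun w hw => ?_) hb
    obtain ⟨o, rfl⟩ := φ.symm.surjective w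
    have hw : (wheelGraph (k + 3)).Adj (some i) o := φ.symm.map_rel_iff.1 hw
    rcases o with _ | j
    · simp
    · have : i - j = 1 ∨ j - i = 1 := SimpleGraph.cycleGraph_adj.1 hw
      rcases this with h | h
      · have : j = i - 1 := by rw [← h]; abel
        simp [this]
      · have : j = i + 1 := by rw [← h]; abel
        simp [this]
  have hsucc : ∀ i, φ.symm (some i) ∈ H.verts → φ.symm (some (i + 1)) ∈ H.verts := by
    intro i hi
    refine (hrim i hi _ (hlift _ _ ?_)).snd_mem
    change (SimpleGraph.cycleGraph (k + 3)).Adj i (i + 1)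
    exact SimpleGraph.cycleGraph_adj.2 (Or.inr (by abel))
  obtain ⟨i, hi⟩ : ∃ i, φ.symm (some i) ∈ H.verts := by
    obtain ⟨v, hv⟩ := hH.1
    obtain ⟨o, rfl⟩ := φ.symm.surjective v
    rcases o with _ | i
    · obtain ⟨w, hw, -, -⟩ := hH.exists_adj hv (φ.symm none) (φ.symm none)
      obtain ⟨o, rfl⟩ := φ.symm.surjective w
      rcases o with _ | i
      · exact absurd rfl hw.ne
      · exact ⟨i, hw.snd_mem⟩
    · exact ⟨i, hv⟩
  have hall : ∀ j, φ.symm (some j) ∈ H.verts := by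
    have h1 : ∀ n : ℕ, φ.symm (some (i + (n : Fin (k + 3)))) ∈ H.verts := by
      intro n
      induction n with
      | zero => simpa using hi
      | succ n ih =>
        have := hsucc _ ih
        rwa [add_assoc, ← Nat.cast_succ] at this
    intro j
    have := h1 (j - i : Fin (k + 3)).val
    rw [Fin.cast_val_eq_self] at this
    simpa using this
  refine subgraph_eq_top (fun v => ?_) fun a b hab => ?_
  · obtain ⟨o, rfl⟩ := φ.symm.surjective v
    rcases o with _ | j
    · exact (hrim i hi _ (hlift (some i) none trivial)).snd_mem
    · exact hall j
  · obtain ⟨o, rfl⟩ := φ.symm.surjective a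
    obtain ⟨o', rfl⟩ := φ.symm.surjective b
    rcases o with _ | j
    · rcases o' with _ | j'
      · exact absurd hab G.irrefl
      · exact (hrim j' (hall j') _ hab.symm).symm
    · exact hrim j (hall j) _ hab

end wheel

end converse

/-! ### Neighbourhoods and edge count of H_n -/

section hGraph

/-- The vertices of `H_n` as a sum. -/
def hVertexEquiv (n : ℕ) : HVertex n ≃ Option (Option (Fin (n - 2))) where
  toFun
    | .x => none
    | .y => some none
    | .v i => some (some i)
  invFun
    | none => .x
    | some none => .y
    | some (some i) => .v i
  left_inv := by rintro (_ | _ | i) <;> rfl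
  right_inv := by rintro (_ | _ | i) <;> rfl

instance (n : ℕ) : Fintype (HVertex n) := Fintype.ofEquiv _ (hVertexEquiv n).symm

theorem card_hVertex {n : ℕ} (hn : 4 ≤ n) : Fintype.card (HVertex n) = n := by
  rw [Fintype.card_congr (hVertexEquiv n)]
  simp
  omega

theorem sum_hVertex {n : ℕ} (F : HVertex n → ℕ) :
    ∑ a, F a = F .x + (F .y + ∑ i, F (.v i)) := by
  rw [← (hVertexEquiv n).symm.sum_comp, Fintype.sum_option, Fintype.sum_option]
  rfl

/-- The neighbour of `v i` before it on the rim cycle through `y`. -/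
def hPrev {n : ℕ} (i : Fin (n - 2)) : HVertex n :=
  if (i : ℕ) = 0 then .y else .v ⟨i - 1, by omega⟩

/-- The neighbour of `v i` after it on the rim cycle through `y`. -/
def hNext {n : ℕ} (i : Fin (n - 2)) : HVertex n :=
  if h : (i : ℕ) + 1 = n - 2 then .y else .v ⟨i + 1, by omega⟩

theorem hGraph_adj_x {n : ℕ} {b : HVertex n} : (HGraph n).Adj .x b ↔ ∃ i, b = .v i := by
  constructor
  · intro hadj
    rcases ((SimpleGraph.fromRel_adj _ _ _).1 hadj).2 with h | h
    · cases h
      exact ⟨_, rfl⟩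
    · cases h
  · rintro ⟨i, rfl⟩
    exact (HEdge.x i).adj

theorem hGraph_adj_y {n : ℕ} {b : HVertex n} :
    (HGraph n).Adj .y b ↔ ∃ i : Fin (n - 2), ((i : ℕ) = 0 ∨ (i : ℕ) + 1 = n - 2) ∧ b = .v i := by
  constructor
  · intro hadj
    rcases ((SimpleGraph.fromRel_adj _ _ _).1 hadj).2 with h | h
    · cases h with
      | y_first i h0 => exact ⟨i, Or.inl h0, rfl⟩
      | y_last i h0 => exact ⟨i, Or.inr h0, rfl⟩
    · cases h
  · rintro ⟨i, h | h, rfl⟩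
    · exact (HEdge.y_first i h).adj
    · exact (HEdge.y_last i h).adj

theorem hGraph_adj_hPrev {n : ℕ} (i : Fin (n - 2)) : (HGraph n).Adj (.v i) (hPrev i) := by
  unfold hPrev
  split_ifs with h
  · exact (HEdge.y_first i h).adj.symm
  · exact (HEdge.path ⟨i - 1, by omega⟩ i (Nat.sub_add_cancel (by omega))).adj.symm

theorem hGraph_adj_hNext {n : ℕ} (i : Fin (n - 2)) : (HGraph n).Adj (.v i) (hNext i) := by
  unfold hNext
  split_ifs with h
  · exact (HEdge.y_last i h).adj.symm
  · exact (HEdge.path i ⟨i + 1, by omega⟩ rfl).adj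

theorem hGraph_adj_v {n : ℕ} {i : Fin (n - 2)} {b : HVertex n} :
    (HGraph n).Adj (.v i) b ↔ b = .x ∨ b = hPrev i ∨ b = hNext i := by
  constructor
  · intro hadj
    unfold hPrev hNext
    rcases ((SimpleGraph.fromRel_adj _ _ _).1 hadj).2 with h | h
    · cases h with
      | path _ j h0 =>
        right; right
        rw [dif_neg (by omega)]
        congr 1
        exact Fin.ext h0.symm
    · cases h with
      | path j _ h =>
        right; left
        rw [if_neg (by omega)]
        congr 1
        exact Fin.ext (by simp; omega)
      | x => exact Or.inl rfl
      | y_first _ h =>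
        right; left
        rw [if_pos h]
      | y_last _ h =>
        right; right
        rw [dif_pos h]
  · rintro (rfl | rfl | rfl)
    · exact (HEdge.x i).adj.symm
    · exact hGraph_adj_hPrev i
    · exact hGraph_adj_hNext i

theorem hPrev_ne_x {n : ℕ} (i : Fin (n - 2)) : hPrev i ≠ .x := by
  unfold hPrev
  split_ifs <;> exact fun h => by cases h

theorem hNext_ne_x {n : ℕ} (i : Fin (n - 2)) : hNext i ≠ .x := by
  unfold hNext
  split_ifs <;> exact fun h => by cases h

theorem hPrev_ne_hNext {n : ℕ} (hn : 4 ≤ n) (i : Fin (n - 2)) : hPrev i ≠ hNext i := by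
  unfold hPrev hNext
  split_ifs
  · omega
  · exact fun h => by cases h
  · exact fun h => by cases h
  · intro h
    simp only [HVertex.v.injEq, Fin.mk.injEq] at h
    omega

theorem degIn_univ_eq_card {V : Type*} [Fintype V] {G : SimpleGraph V} {v : V} {A : Finset V}
    (h : ∀ w, G.Adj v w ↔ w ∈ A) : degIn G univ v = #A := by
  unfold degIn
  congr 1
  ext w
  simp [h]

/-- The degree sum is 3(n - 2) for the internal vertices, n - 2 for x and 2 for y. -/
theorem ncard_edgeSet_hGraph {n : ℕ} (hn : 4 ≤ n) :
    (HGraph n).edgeSet.ncard + 3 = 2 * n := by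
  classical
  have h := adjPairs_univ_univ (G := HGraph n)
  unfold adjPairs at h
  rw [sum_hVertex] at h
  have hv : ∀ i, degIn (HGraph n) univ (.v i) = 3 := by
    intro i
    rw [degIn_univ_eq_card (A := {.x, hPrev i, hNext i}) fun w => by simp [hGraph_adj_v]]
    exact card_eq_three.2
      ⟨_, _, _, (hPrev_ne_x i).symm, (hNext_ne_x i).symm, hPrev_ne_hNext hn i, rfl⟩
  have hx : degIn (HGraph n) univ .x = n - 2 := by
    rw [degIn_univ_eq_card (A := univ.image HVertex.v) fun w => by simp [hGraph_adj_x, eq_comm],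
      card_image_of_injective _ fun i j h => by simpa using h]
    simp
  have hy : degIn (HGraph n) univ .y = 2 := by
    rw [degIn_univ_eq_card (A := {.v ⟨0, by omega⟩, .v ⟨n - 3, by omega⟩}) fun w => ?_,
      card_pair]
    · simp
      omega
    · rw [hGraph_adj_y]
      simp only [mem_insert, mem_singleton]
      constructor
      · rintro ⟨i, h | h, rfl⟩
        · left
          congr 1
          exact Fin.ext h
        · right
          congr 1
          exact Fin.ext (by simp; omega)
      · rintro (rfl | rfl)
        · exact ⟨_, Or.inl rfl, rfl⟩
        · exact ⟨_, Or.inr (by simp; omega), rfl⟩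
  rw [hx, hy] at h
  simp only [hv, sum_const, card_univ, Fintype.card_fin, smul_eq_mul] at h
  omega

end hGraph

/-! ### Gluings are critical -/

section gluingConverse

variable {V : Type*} {G : SimpleGraph V}

/-- `G` is the union of the copies of `H_i` and `H_j` given by `f` and `g`, which share exactly
their connectors. -/
structure IsGluingOf (G : SimpleGraph V) {i j : ℕ} (f : HVertex i ↪ V) (g : HVertex j ↪ V) :
    Prop where
  connectors : (f .x = g .x ∧ f .y = g .y) ∨ (f .x = g .y ∧ f .y = g .x)
  inter : Set.range f ∩ Set.range g = {f .x, f .y}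
  union : Set.range f ∪ Set.range g = Set.univ
  eq : G = (HGraph i).map f ⊔ (HGraph j).map g

namespace IsGluingOf

variable {i j : ℕ} {f : HVertex i ↪ V} {g : HVertex j ↪ V}

theorem symm (h : IsGluingOf G f g) : IsGluingOf G g f where
  connectors := by
    have := h.connectors
    grind
  inter := by
    rw [Set.inter_comm, h.inter]
    rcases h.connectors with ⟨h1, h2⟩ | ⟨h1, h2⟩
    · rw [h1, h2]
    · rw [h1, h2, Set.pair_comm]
  union := by rw [Set.union_comm, h.union]
  eq := by rw [sup_comm, h.eq]

theorem adj_iff (h : IsGluingOf G f g) {a b : V} : G.Adj a b ↔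
    (∃ a' b', (HGraph i).Adj a' b' ∧ f a' = a ∧ f b' = b) ∨
      ∃ a' b', (HGraph j).Adj a' b' ∧ g a' = a ∧ g b' = b := by
  have := h.eq
  subst this
  rw [SimpleGraph.sup_adj, SimpleGraph.map_adj, SimpleGraph.map_adj]

theorem adj (h : IsGluingOf G f g) {a b : HVertex i} (hab : (HGraph i).Adj a b) :
    G.Adj (f a) (f b) :=
  h.adj_iff.2 (Or.inl ⟨a, b, hab, rfl, rfl⟩)

theorem eq_connector (h : IsGluingOf G f g) {a : HVertex i} {b : HVertex j} (hab : f a = g b) :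
    (a = .x ∨ a = .y) ∧ (b = .x ∨ b = .y) := by
  have h1 : f a ∈ Set.range f ∩ Set.range g := ⟨⟨a, rfl⟩, ⟨b, hab.symm⟩⟩
  have h2 := h1
  rw [h.inter] at h1
  rw [Set.inter_comm, h.symm.inter, hab] at h2
  simp only [Set.mem_insert_iff, Set.mem_singleton_iff, f.injective.eq_iff,
    g.injective.eq_iff] at h1 h2
  exact ⟨h1, h2⟩

theorem adj_v (h : IsGluingOf G f g) {k : Fin (i - 2)} {b : V} (hb : G.Adj (f (.v k)) b) :
    ∃ b', (HGraph i).Adj (.v k) b' ∧ f b' = b := by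
  rcases h.adj_iff.1 hb with ⟨a', b', hab, ha, hb⟩ | ⟨a', b', hab, ha, hb⟩
  · obtain rfl := f.injective ha
    exact ⟨b', hab, hb⟩
  · rcases (h.eq_connector ha.symm).1 with h | h <;> cases h

theorem subgraph_adj_v (h : IsGluingOf G f g) {H : G.Subgraph} (hH : HasMinDegThree H)
    {k : Fin (i - 2)} (hk : f (.v k) ∈ H.verts) {b : HVertex i} (hb : (HGraph i).Adj (.v k) b) :
    H.Adj (f (.v k)) (f b) := by
  classical
  refine hH.adj hk (A := {f .x, f (hPrev k), f (hNext k)}) card_le_three (fun w hw => ?_) (h.adj hb)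
  obtain ⟨b', hb', rfl⟩ := h.adj_v hw
  rcases hGraph_adj_v.1 hb' with rfl | rfl | rfl <;> simp

/-- Internal vertices are cubic in G, so membership in H spreads along the path in both directions.
-/
theorem subgraph_mem_v (h : IsGluingOf G f g) {H : G.Subgraph} (hH : HasMinDegThree H)
    {k : Fin (i - 2)} (hk : f (.v k) ∈ H.verts) (l : Fin (i - 2)) : f (.v l) ∈ H.verts := by
  have hup : ∀ d : ℕ, ∀ hd : k + d < i - 2, f (.v ⟨k + d, hd⟩) ∈ H.verts := by
    intro d
    induction d with
    | zero => exact fun _ => hk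
    | succ d ih =>
      intro hd
      exact (h.subgraph_adj_v hH (ih (by omega)) (HEdge.path _ _ rfl).adj).snd_mem
  have hdown : ∀ d : ℕ, ∀ hd : d ≤ k, f (.v ⟨k - d, by omega⟩) ∈ H.verts := by
    intro d
    induction d with
    | zero => exact fun _ => hk
    | succ d ih =>
      intro hd
      exact (h.subgraph_adj_v hH (ih (by omega))
        (HEdge.path ⟨k - (d + 1), by omega⟩ ⟨k - d, by omega⟩ (by simp; omega)).adj.symm).snd_mem
  rcases le_total (k : ℕ) l with hkl | hkl
  · have := hup (l - k) (by omega)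
    convert this using 3
    exact Fin.ext (by simp; omega)
  · have := hdown (k - l) (by omega)
    convert this using 3
    exact Fin.ext (by simp; omega)

theorem subgraph_adj (h : IsGluingOf G f g) {H : G.Subgraph} (hH : HasMinDegThree H)
    {k : Fin (i - 2)} (hk : f (.v k) ∈ H.verts) {a b : HVertex i} (hab : (HGraph i).Adj a b) :
    H.Adj (f a) (f b) := by
  have hall := h.subgraph_mem_v hH hk
  rcases a with _ | _ | l
  · obtain ⟨l, rfl⟩ := hGraph_adj_x.1 hab
    exact (h.subgraph_adj_v hH (hall l) hab.symm).symm
  · obtain ⟨l, -, rfl⟩ := hGraph_adj_y.1 hab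
    exact (h.subgraph_adj_v hH (hall l) hab.symm).symm
  · exact h.subgraph_adj_v hH (hall l) hab

theorem subgraph_mem (h : IsGluingOf G f g) (hi : 4 ≤ i) {H : G.Subgraph} (hH : HasMinDegThree H)
    {k : Fin (i - 2)} (hk : f (.v k) ∈ H.verts) (a : HVertex i) : f a ∈ H.verts := by
  rcases a with _ | _ | l
  · exact (h.subgraph_adj hH hk (HEdge.x k).adj).fst_mem
  · exact (h.subgraph_adj hH hk (HEdge.y_first ⟨0, by omega⟩ rfl).adj).fst_mem
  · exact h.subgraph_mem_v hH hk l

/-- The connector y has only two neighbours in its own copy, so its third neighbour in H is in the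
other copy, where neighbours of connectors are internal. -/
theorem exists_other_v_mem (h : IsGluingOf G f g) (hi : 4 ≤ i) {H : G.Subgraph}
    (hH : HasMinDegThree H) {k : Fin (i - 2)} (hk : f (.v k) ∈ H.verts) :
    ∃ l, g (.v l) ∈ H.verts := by
  obtain ⟨w, hw, h1, h2⟩ := hH.exists_adj (h.subgraph_mem hi hH hk .y)
    (f (.v ⟨0, by omega⟩)) (f (.v ⟨i - 3, by omega⟩))
  rcases h.adj_iff.1 (H.adj_sub hw) with ⟨a', b', hab, ha, rfl⟩ | ⟨a', b', hab, ha, rfl⟩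
  · obtain rfl := f.injective ha
    obtain ⟨l, hl | hl, rfl⟩ := hGraph_adj_y.1 hab
    · exact absurd (by congr 2; exact Fin.ext hl) h1
    · exact absurd (by congr 2; exact Fin.ext (by simp; omega)) h2
  · rcases (h.eq_connector ha.symm).2 with rfl | rfl
    · obtain ⟨l, rfl⟩ := hGraph_adj_x.1 hab
      exact ⟨l, hw.snd_mem⟩
    · obtain ⟨l, -, rfl⟩ := hGraph_adj_y.1 hab
      exact ⟨l, hw.snd_mem⟩

theorem eq_top_of_v_mem (h : IsGluingOf G f g) (hi : 4 ≤ i) (hj : 4 ≤ j) {H : G.Subgraph}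
    (hH : HasMinDegThree H) {k : Fin (i - 2)} (hk : f (.v k) ∈ H.verts) : H = ⊤ := by
  obtain ⟨l, hl⟩ := h.exists_other_v_mem hi hH hk
  refine subgraph_eq_top (fun v => ?_) fun a b hab => ?_
  · rcases (h.union ▸ Set.mem_univ v : v ∈ Set.range f ∪ Set.range g) with ⟨a, rfl⟩ | ⟨a, rfl⟩
    · exact h.subgraph_mem hi hH hk a
    · exact h.symm.subgraph_mem hj hH hl a
  · rcases h.adj_iff.1 hab with ⟨a', b', hab', rfl, rfl⟩ | ⟨a', b', hab', rfl, rfl⟩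
    · exact h.subgraph_adj hH hk hab'
    · exact h.symm.subgraph_adj hH hl hab'

theorem exists_v_mem (h : IsGluingOf G f g) {H : G.Subgraph} (hH : HasMinDegThree H)
    {a : HVertex i} (ha : f a ∈ H.verts) :
    (∃ k, f (.v k) ∈ H.verts) ∨ ∃ k, g (.v k) ∈ H.verts := by
  by_cases hav : ∃ k, a = .v k
  · obtain ⟨k, rfl⟩ := hav
    exact Or.inl ⟨k, ha⟩
  obtain ⟨w, hw, -, -⟩ := hH.exists_adj ha (f a) (f a)
  have key : ∀ {n : ℕ} {a b : HVertex n}, (HGraph n).Adj a b →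
      (∃ k, a = .v k) ∨ ∃ k, b = .v k := by
    intro n a b hab
    rcases a with _ | _ | k
    · exact Or.inr (hGraph_adj_x.1 hab)
    · obtain ⟨k, -, rfl⟩ := hGraph_adj_y.1 hab
      exact Or.inr ⟨k, rfl⟩
    · exact Or.inl ⟨k, rfl⟩
  rcases h.adj_iff.1 (H.adj_sub hw) with ⟨a', b', hab, ha', rfl⟩ | ⟨a', b', hab, ha', rfl⟩
  · rcases key hab with ⟨k, rfl⟩ | ⟨k, rfl⟩
    · exact Or.inl ⟨k, ha' ▸ ha⟩
    · exact Or.inl ⟨k, hw.snd_mem⟩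
  · rcases key hab with ⟨k, rfl⟩ | ⟨k, rfl⟩
    · exact Or.inr ⟨k, ha' ▸ ha⟩
    · exact Or.inr ⟨k, hw.snd_mem⟩

theorem eq_top (h : IsGluingOf G f g) (hi : 4 ≤ i) (hj : 4 ≤ j) {H : G.Subgraph}
    (hH : HasMinDegThree H) : H = ⊤ := by
  have : (∃ k, f (.v k) ∈ H.verts) ∨ ∃ k, g (.v k) ∈ H.verts := by
    obtain ⟨v, hv⟩ := hH.1
    rcases (h.union ▸ Set.mem_univ v : v ∈ Set.range f ∪ Set.range g) with ⟨a, rfl⟩ | ⟨a, rfl⟩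
    · exact h.exists_v_mem hH hv
    · exact (h.symm.exists_v_mem hH hv).symm
  rcases this with ⟨k, hk⟩ | ⟨k, hk⟩
  · exact h.eq_top_of_v_mem hi hj hH hk
  · exact h.symm.eq_top_of_v_mem hj hi hH hk

theorem card_eq [Fintype V] (h : IsGluingOf G f g) (hi : 4 ≤ i) (hj : 4 ≤ j) :
    Fintype.card V + 2 = i + j := by
  have h1 := Set.ncard_union_add_ncard_inter (Set.range f) (Set.range g)
  have hr : ∀ {n : ℕ} (_ : 4 ≤ n) (e : HVertex n ↪ V), (Set.range e).ncard = n := by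
    intro n hn e
    rw [← Set.image_univ, Set.ncard_image_of_injective _ e.injective, Set.ncard_univ,
      Nat.card_eq_fintype_card, card_hVertex hn]
  rw [h.union, h.inter, hr hi, hr hj, Set.ncard_univ, Nat.card_eq_fintype_card,
    Set.ncard_pair fun h => by cases f.injective h] at h1
  exact h1

/-- A common edge of the copies would join the two connectors, which are not adjacent in H_n; so the
edge counts add up. -/
theorem ncard_edgeSet [Fintype V] (h : IsGluingOf G f g) (hi : 4 ≤ i) (hj : 4 ≤ j) :
    G.edgeSet.ncard + 6 = 2 * (i + j) := by
  have hm : ∀ {n : ℕ} (_ : 4 ≤ n) (e : HVertex n ↪ V),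
      ((HGraph n).map e).edgeSet.ncard + 3 = 2 * n := by
    intro n hn e
    rw [SimpleGraph.edgeSet_map, Set.ncard_image_of_injective _ e.sym2Map.injective,
      ncard_edgeSet_hGraph hn]
  have hdis : Disjoint ((HGraph i).map f).edgeSet ((HGraph j).map g).edgeSet := by
    rw [Set.disjoint_left]
    intro e
    induction e with | _ a b
    simp only [SimpleGraph.mem_edgeSet, SimpleGraph.map_adj]
    rintro ⟨a, b, hab, rfl, rfl⟩ ⟨a', b', -, ha, hb⟩
    have ha := (h.eq_connector ha.symm).1
    have hb := (h.eq_connector hb.symm).1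
    rcases ha with rfl | rfl
    · obtain ⟨k, rfl⟩ := hGraph_adj_x.1 hab
      rcases hb with h | h <;> cases h
    · obtain ⟨k, -, rfl⟩ := hGraph_adj_y.1 hab
      rcases hb with h | h <;> cases h
  have h1 := hm hi f
  have h2 := hm hj g
  rw [h.eq, SimpleGraph.edgeSet_sup, Set.ncard_union_eq hdis]
  omega

end IsGluingOf

theorem IsHGluing.nonInducedCritical [Fintype V] (hG : IsHGluing G) : NonInducedCritical G := by
  obtain ⟨i, j, hi, hj, f, g, h1, h2, h3, h4⟩ := hG
  have h : IsGluingOf G f g := ⟨h1, h2, h3, h4⟩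
  have hc := h.card_eq hi hj
  have he := h.ncard_edgeSet hi hj
  exact nonInducedCritical_of (by omega) fun H hH => h.eq_top hi hj hH

end gluingConverse

theorem mainTheorem3 {V : Type*} [Fintype V] (hV : 2 ≤ Fintype.card V) (G : SimpleGraph V) :
    NonInducedCritical G ↔ IsWheel G ∨ IsHGluing G :=
  ⟨fun h => (h.isTight hV).isWheel_or_isHGluing hV,
    fun h => h.elim IsWheel.nonInducedCritical IsHGluing.nonInducedCritical⟩
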